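/- We work over $\mathbb{C}$. Let $h:L\to M$ and $g:N\to M$ be morphisms of differential graded Lie algebras (DGLAs), $\mathbf{Art}$ the category of local Artinian $\mathbb{C}$-algebras $(A,\mathfrak m_A)$ with residue field $\mathbb{C}$. For a DGLA $L$ put $\mathrm{MC}_L(A)=\{x\in L^1\otimes\mathfrak m_A : dx+\tfrac12[x,x]=0\}$, and for $a\in L^0\otimes\mathfrak m_A$ put $e^a*x=x+\sum_{n\ge0}\frac{[a,-]^n}{(n+1)!}([a,x]-da)$. The Maurer–Cartan functor of the pair $(h,g)$ is $$\mathrm{MC}_{(h,g)}(A)=\{(l,n,e^m)\in \mathrm{MC}_L(A)\times \mathrm{MC}_N(A)\times \exp(M^0\otimes\mathfrak m_A) : g(n)=e^m*h(l)\}.$$ The cone $C_{(h,g)}$ is the complex $C^i_{(h,g)}=L^i\oplus N^i\oplus M^{i-1}$, $D(l,n,m)=(dl,dn,-dm-g(n)+h(l))$. Let $H_{(h,g)}=\{(l,n,m(t,dt))\in L\times N\times M[t,dt] : h(l)=m(1),\ g(n)=m(0)\}$, a DGLA, with $q_1=-d$ and $q_2(x\odot y)=(-1)^{\deg x}[x,y]$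 on its suspension. Put $$\imath(l,n,m)=(l,n,(1-t)g(n)+th(l)+dt\,m),\qquad \pi(l,n,m(t,dt))=\Big(l,n,\int_0^1 m(t,dt)\Big),$$ $$K(l,n,m(t,dt))=\Big(0,0,t\int_0^1 m(t,dt)-\int_0^t m(s,ds)\Big).$$ Equip $C_{(h,g)}$ with the brackets $\langle\ \rangle_n$ on its suspension that are transferred from $H_{(h,g)}$ along $(\imath,\pi,K)$, namely $\langle\gamma\rangle_1=-D\gamma$ and, for $n\ge2$, $$\langle\gamma_1\odot\cdots\odot\gamma_n\rangle_n=\frac{(-1)^{n-2}}2\sum_{\sigma\in\Sigma_n}\varepsilon(\sigma)\,\pi q_2(\imath(\gamma_{\sigma(1)})\odot Kq_2(\imath(\gamma_{\sigma(2)})\odot\cdots\odot Kq_2(\imath(\gamma_{\sigma(n-1)})\odot\imath(\gamma_{\sigma(n)}))\cdots)),$$ where $\varepsilon(\sigma)$ is the Koszul sign of the suspended elements. Let $\mathrm{MC}^\infty_{C_{(h,g)}}(A)=\{\gamma\in C^1_{(h,g)}\otimes\mathfrak m_A : \sum_{j\ge1}\frac1{j!}\langle\gamma^{\odot j}\rangle_j=0\}$,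 with the brackets extended multilinearly to coefficients in $A$. Then: 1. $(l,n,e^m)\mapsto(l,n,m)$ defines an isomorphism $\mathrm{MC}_{(h,g)}\cong\mathrm{MC}^\infty_{C_{(h,g)}}$ of functors $\mathbf{Art}\to\mathbf{Set}$. 2. For every $A\in\mathbf{Art}$, $l\in L^1\otimes\mathfrak m_A$, $n\in N^1\otimes\mathfrak m_A$ and $m\in M^0\otimes\mathfrak m_A$, the element $(l,n,m)$ lies in $\mathrm{MC}^\infty_{C_{(h,g)}}(A)$ if and only if $dl+\tfrac12[l,l]=0$, $dn+\tfrac12[n,n]=0$ and $g(n)=e^m*h(l)$. 3. For $m\in M^0$, $l\in L$ and $n\in N$ (write $m,l,n$ also for $(0,0,m),(l,0,0),(0,n,0)$), and $B_j$ the Bernoulli numbers ($\sum_j B_jx^j/j!=x/(e^x-1)$): $\langle m\odot l\rangle_2=-\tfrac12[m,h(l)]$; $\langle m^{\odot j}\odot l\rangle_{j+1}=-B_j\,\mathrm{ad}_m^j(h(l))$ for $j\ge2$; and $\langle m^{\odot j}\odot n\rangle_{j+1}=B_j\,\mathrm{ad}_m^j(g(n))$ for $j\ge1$. The right-hand sides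 are elements of the summand $M$ of the cone. -/

import Mathlib

open scoped TensorProduct Polynomial

universe u v

noncomputable section

/-- A grading of a `𝕜`-vector space by `ℤ`: a family of subspaces of which the space is the
internal direct sum. -/
structure Grading (𝕜 : Type*) [Field 𝕜] (V : Type*) [AddCommGroup V] [Module 𝕜 V] where
  deg : ℤ → Submodule 𝕜 V
  internal : DirectSum.IsInternal deg

namespace Grading

variable {𝕜 : Type*} [Field 𝕜] {V W : Type*} [AddCommGroup V] [Module 𝕜 V]
  [AddCommGroup W] [Module 𝕜 W]

/-- The linear map that multiplies the component of degree `i` by `c i`. -/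
def scale (G : Grading 𝕜 V) (c : ℤ → 𝕜) : V →ₗ[𝕜] V :=
  DirectSum.toModule 𝕜 ℤ V (fun i => c i • (G.deg i).subtype) ∘ₗ
    ((LinearEquiv.ofBijective (DirectSum.coeLinearMap G.deg)
      (show Function.Bijective _ from G.internal)).symm :
      V →ₗ[𝕜] DirectSum ℤ fun i => G.deg i)

theorem scale_of_mem (G : Grading 𝕜 V) (c : ℤ → 𝕜) {i : ℤ} {v : V} (hv : v ∈ G.deg i) :
    G.scale c v = c i • v := by
  have h : (LinearEquiv.ofBijective (DirectSum.coeLinearMap G.deg)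
      (show Function.Bijective _ from G.internal)).symm v
      = DirectSum.lof 𝕜 ℤ (fun i => G.deg i) i ⟨v, hv⟩ := by
    rw [LinearEquiv.symm_apply_eq]
    exact (DirectSum.coeLinearMap_lof G.deg i ⟨v, hv⟩).symm
  simp [scale, h]

/-- The projection onto the component of degree `i`. -/
def proj (G : Grading 𝕜 V) (i : ℤ) : V →ₗ[𝕜] V := G.scale (Pi.single i 1)

/-- The projection onto the sum of the components of degree congruent to `e` modulo 2. -/
def parityProj (G : Grading 𝕜 V) (e : ZMod 2) : V →ₗ[𝕜] V :=
  G.scale fun i => if (i : ZMod 2) = e then 1 else 0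

/-- The operator `v ↦ (-1)^(deg v) v`. -/
def sgn (G : Grading 𝕜 V) : V →ₗ[𝕜] V := G.scale fun i => (-1) ^ i

theorem proj_of_mem (G : Grading 𝕜 V) {i : ℤ} {v : V} (hv : v ∈ G.deg i) : G.proj i v = v := by
  simp [proj, G.scale_of_mem _ hv]

theorem proj_of_mem_ne (G : Grading 𝕜 V) {i j : ℤ} (hij : i ≠ j) {v : V} (hv : v ∈ G.deg j) :
    G.proj i v = 0 := by
  simp [proj, G.scale_of_mem _ hv, Pi.single_eq_of_ne (Ne.symm hij)]

theorem sgn_of_mem (G : Grading 𝕜 V) {i : ℤ} {v : V} (hv : v ∈ G.deg i) :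
    G.sgn v = (-1 : 𝕜) ^ i • v := G.scale_of_mem _ hv

theorem induction_on (G : Grading 𝕜 V) {P : V → Prop} (v : V)
    (hmem : ∀ i, ∀ v ∈ G.deg i, P v) (h0 : P 0) (hadd : ∀ v w, P v → P w → P (v + w)) : P v := by
  have hv : v ∈ ⨆ i, G.deg i := by
    rw [G.internal.submodule_iSup_eq_top]; trivial
  exact Submodule.iSup_induction G.deg (motive := P) hv hmem h0 hadd

theorem proj_mem (G : Grading 𝕜 V) (i : ℤ) (v : V) : G.proj i v ∈ G.deg i := by
  induction v using G.induction_on with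
  | hmem j v hv =>
    by_cases h : i = j
    · subst h; rwa [G.proj_of_mem hv]
    · rw [G.proj_of_mem_ne h hv]; exact zero_mem _
  | h0 => simp
  | hadd v w hv hw => rw [map_add]; exact add_mem hv hw

theorem exists_sum_proj (G : Grading 𝕜 V) (v : V) :
    ∃ s : Finset ℤ, ∀ t, s ⊆ t → ∑ i ∈ t, G.proj i v = v := by
  induction v using G.induction_on with
  | hmem j v hv =>
    refine ⟨{j}, fun t ht => ?_⟩
    rw [Finset.sum_eq_single_of_mem j (ht (by simp)), G.proj_of_mem hv]
    intro i _ hi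
    exact G.proj_of_mem_ne hi hv
  | h0 => exact ⟨∅, by simp⟩
  | hadd v w hv hw =>
    obtain ⟨s, hs⟩ := hv
    obtain ⟨s', hs'⟩ := hw
    refine ⟨s ∪ s', fun t ht => ?_⟩
    simp only [map_add, Finset.sum_add_distrib]
    rw [hs t (Finset.union_subset_left ht), hs' t (Finset.union_subset_right ht)]

theorem map_scale (G : Grading 𝕜 V) (G' : Grading 𝕜 W) (f : V →ₗ[𝕜] W)
    (hf : ∀ i, ∀ v ∈ G.deg i, f v ∈ G'.deg i) (c : ℤ → 𝕜) (v : V) :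
    f (G.scale c v) = G'.scale c (f v) := by
  induction v using G.induction_on with
  | hmem j v hv => rw [G.scale_of_mem c hv, G'.scale_of_mem c (hf _ _ hv), map_smul]
  | h0 => simp
  | hadd v w hv hw => simp only [map_add, hv, hw]

/-- A family of subspaces with a complete family of projections is a grading. -/
def ofProj (deg : ℤ → Submodule 𝕜 V) (pr : ℤ → V →ₗ[𝕜] V) (hmem : ∀ i v, pr i v ∈ deg i)
    (hself : ∀ i, ∀ v ∈ deg i, pr i v = v) (hne : ∀ i j, i ≠ j → ∀ v ∈ deg j, pr i v = 0)
    (hsum : ∀ v, ∃ s : Finset ℤ, ∀ t, s ⊆ t → ∑ i ∈ t, pr i v = v) : Grading 𝕜 V where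
  deg := deg
  internal := by
    apply DirectSum.isInternal_submodule_of_iSupIndep_of_iSup_eq_top
    · intro i
      rw [Submodule.disjoint_def]
      intro v hv hv'
      rw [← hself i v hv]
      have hle : (⨆ (j) (_ : j ≠ i), deg j) ≤ LinearMap.ker (pr i) :=
        iSup₂_le fun j hj v hv => hne i j hj.symm v hv
      exact hle hv'
    · rw [eq_top_iff]
      intro v _
      obtain ⟨s, hs⟩ := hsum v
      rw [← hs s subset_rfl]
      exact Submodule.sum_mem _ fun i _ => (le_iSup deg i) (hmem i v)

/-- The direct sum of two graded vector spaces. -/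
def prod (G : Grading 𝕜 V) (G' : Grading 𝕜 W) : Grading 𝕜 (V × W) :=
  ofProj (fun i => (G.deg i).prod (G'.deg i)) (fun i => (G.proj i).prodMap (G'.proj i))
    (fun i v => ⟨G.proj_mem i _, G'.proj_mem i _⟩)
    (fun i v hv => Prod.ext (G.proj_of_mem hv.1) (G'.proj_of_mem hv.2))
    (fun i j h v hv => Prod.ext (G.proj_of_mem_ne h hv.1) (G'.proj_of_mem_ne h hv.2))
    (fun v => by
      obtain ⟨s, hs⟩ := G.exists_sum_proj v.1
      obtain ⟨s', hs'⟩ := G'.exists_sum_proj v.2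
      refine ⟨s ∪ s', fun t ht => Prod.ext ?_ ?_⟩
      · simpa [Prod.fst_sum] using hs t (Finset.union_subset_left ht)
      · simpa [Prod.snd_sum] using hs' t (Finset.union_subset_right ht))

/-- The grading shifted by one: the new component of degree `i` is the old one of degree
`i - 1`. -/
def shift (G : Grading 𝕜 V) : Grading 𝕜 V :=
  ofProj (fun i => G.deg (i - 1)) (fun i => G.proj (i - 1))
    (fun i v => G.proj_mem _ v) (fun i v hv => G.proj_of_mem hv)
    (fun i j h v hv => G.proj_of_mem_ne (by omega) hv)
    (fun v => by
      obtain ⟨s, hs⟩ := G.exists_sum_proj v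
      refine ⟨s.map (Equiv.addRight (1 : ℤ)).toEmbedding, fun t ht => ?_⟩
      have := hs (t.map (Equiv.subRight (1 : ℤ)).toEmbedding) (by
        intro i hi
        rw [Finset.mem_map]
        exact ⟨i + 1, ht (by simpa using hi), by simp⟩)
      rwa [Finset.sum_map] at this)

/-- The grading of `U ⊗ V` in which `U` is put in degree zero. -/
def lTensor (U : Type*) [AddCommGroup U] [Module 𝕜 U] (G : Grading 𝕜 V) : Grading 𝕜 (U ⊗[𝕜] V) :=
  ofProj (fun i => LinearMap.range ((G.deg i).subtype.lTensor U)) (fun i => (G.proj i).lTensor U)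
    (fun i v => by
      have h : (G.proj i).lTensor U = (G.deg i).subtype.lTensor U ∘ₗ
          ((G.proj i).codRestrict (G.deg i) (G.proj_mem i)).lTensor U := by
        rw [← LinearMap.lTensor_comp]; rfl
      rw [h]; exact ⟨_, rfl⟩)
    (by
      rintro i _ ⟨v, rfl⟩
      rw [← LinearMap.comp_apply, ← LinearMap.lTensor_comp]
      congr 2
      ext v; exact G.proj_of_mem v.2)
    (by
      rintro i j h _ ⟨v, rfl⟩
      rw [← LinearMap.comp_apply, ← LinearMap.lTensor_comp]
      have : G.proj i ∘ₗ (G.deg j).subtype = 0 := by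
        ext v; exact G.proj_of_mem_ne h v.2
      rw [this]; simp)
    (fun v => by
      induction v using TensorProduct.induction_on with
      | zero => exact ⟨∅, by simp⟩
      | tmul u v =>
        obtain ⟨s, hs⟩ := G.exists_sum_proj v
        refine ⟨s, fun t ht => ?_⟩
        simp [← TensorProduct.tmul_sum, hs t ht]
      | add v w hv hw =>
        obtain ⟨s, hs⟩ := hv
        obtain ⟨s', hs'⟩ := hw
        refine ⟨s ∪ s', fun t ht => ?_⟩
        simp only [map_add, Finset.sum_add_distrib]
        rw [hs t (Finset.union_subset_left ht), hs' t (Finset.union_subset_right ht)])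

/-- The grading induced on a graded subspace. -/
def restrict (G : Grading 𝕜 V) (S : Submodule 𝕜 V) (hS : ∀ i, ∀ v ∈ S, G.proj i v ∈ S) :
    Grading 𝕜 S :=
  ofProj (fun i => (G.deg i).comap S.subtype) (fun i => (G.proj i).restrict (hS i))
    (fun i v => G.proj_mem i _)
    (fun i v hv => Subtype.ext (G.proj_of_mem hv))
    (fun i j h v hv => Subtype.ext (G.proj_of_mem_ne h hv))
    (fun v => by
      obtain ⟨s, hs⟩ := G.exists_sum_proj v
      refine ⟨s, fun t ht => Subtype.ext ?_⟩
      simpa using hs t ht)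

end Grading

/-- A differential graded Lie algebra structure on the vector space `V = ⨁ Vⁱ`. -/
structure DGLA (𝕜 : Type*) [Field 𝕜] (V : Type*) [AddCommGroup V] [Module 𝕜 V] extends
    Grading 𝕜 V where
  d : V →ₗ[𝕜] V
  bracket : V →ₗ[𝕜] V →ₗ[𝕜] V
  d_mem : ∀ i, ∀ v ∈ deg i, d v ∈ deg (i + 1)
  d_d : ∀ v, d (d v) = 0
  bracket_mem : ∀ i j, ∀ v ∈ deg i, ∀ w ∈ deg j, bracket v w ∈ deg (i + j)
  skew : ∀ i j, ∀ v ∈ deg i, ∀ w ∈ deg j, bracket v w = -((-1 : 𝕜) ^ (i * j) • bracket w v)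
  jacobi : ∀ i j k, ∀ u ∈ deg i, ∀ v ∈ deg j, ∀ w ∈ deg k,
    bracket u (bracket v w) =
      bracket (bracket u v) w + (-1 : 𝕜) ^ (i * j) • bracket v (bracket u w)
  leibniz : ∀ i j, ∀ v ∈ deg i, ∀ w ∈ deg j,
    d (bracket v w) = bracket (d v) w + (-1 : 𝕜) ^ i • bracket v (d w)

/-- A morphism of differential graded Lie algebras. -/
structure DGLA.Hom {𝕜 : Type*} [Field 𝕜] {V W : Type*} [AddCommGroup V] [Module 𝕜 V]
    [AddCommGroup W] [Module 𝕜 W] (X : DGLA 𝕜 V) (Y : DGLA 𝕜 W) where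
  toLin : V →ₗ[𝕜] W
  map_mem : ∀ i, ∀ v ∈ X.deg i, toLin v ∈ Y.deg i
  map_d : ∀ v, toLin (X.d v) = Y.d (toLin v)
  map_bracket : ∀ v w, toLin (X.bracket v w) = Y.bracket (toLin v) (toLin w)

namespace DGLA

variable {𝕜 : Type*} [Field 𝕜] {V W : Type*} [AddCommGroup V] [Module 𝕜 V]
  [AddCommGroup W] [Module 𝕜 W]

/-- The product of two differential graded Lie algebras. -/
def prod (X : DGLA 𝕜 V) (Y : DGLA 𝕜 W) : DGLA 𝕜 (V × W) where
  toGrading := X.toGrading.prod Y.toGrading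
  d := X.d.prodMap Y.d
  bracket := LinearMap.mk₂ 𝕜 (fun x y => (X.bracket x.1 y.1, Y.bracket x.2 y.2))
    (by intros; ext <;> simp) (by intros; ext <;> simp)
    (by intros; ext <;> simp) (by intros; ext <;> simp)
  d_mem i v hv := ⟨X.d_mem i _ hv.1, Y.d_mem i _ hv.2⟩
  d_d v := Prod.ext (X.d_d _) (Y.d_d _)
  bracket_mem i j v hv w hw := ⟨X.bracket_mem i j _ hv.1 _ hw.1, Y.bracket_mem i j _ hv.2 _ hw.2⟩
  skew i j v hv w hw := Prod.ext (X.skew i j _ hv.1 _ hw.1) (Y.skew i j _ hv.2 _ hw.2)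
  jacobi i j k u hu v hv w hw := Prod.ext (X.jacobi i j k _ hu.1 _ hv.1 _ hw.1)
    (Y.jacobi i j k _ hu.2 _ hv.2 _ hw.2)
  leibniz i j v hv w hw := Prod.ext (X.leibniz i j _ hv.1 _ hw.1) (Y.leibniz i j _ hv.2 _ hw.2)

/-- A graded subspace closed under the differential and the bracket is a differential graded Lie
algebra. -/
def restrict (X : DGLA 𝕜 V) (S : Submodule 𝕜 V) (hS : ∀ i, ∀ v ∈ S, X.proj i v ∈ S)
    (hd : ∀ v ∈ S, X.d v ∈ S) (hb : ∀ v ∈ S, ∀ w ∈ S, X.bracket v w ∈ S) : DGLA 𝕜 S where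
  toGrading := X.toGrading.restrict S hS
  d := X.d.restrict hd
  bracket := LinearMap.mk₂ 𝕜 (fun x y => ⟨X.bracket x y, hb x x.2 y y.2⟩)
    (by intros; ext; simp) (by intros; ext; simp) (by intros; ext; simp) (by intros; ext; simp)
  d_mem i v hv := X.d_mem i v hv
  d_d v := Subtype.ext (X.d_d v)
  bracket_mem i j v hv w hw := X.bracket_mem i j v hv w hw
  skew i j v hv w hw := Subtype.ext (X.skew i j v hv w hw)
  jacobi i j k u hu v hv w hw := Subtype.ext (X.jacobi i j k u hu v hv w hw)
  leibniz i j v hv w hw := Subtype.ext (X.leibniz i j v hv w hw)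

/-- The `𝕜[t]`-bilinear extension of the bracket of `V` to `𝕜[t] ⊗ V`. -/
def polyBracket (X : DGLA 𝕜 V) : (𝕜[X] ⊗[𝕜] V) →ₗ[𝕜] (𝕜[X] ⊗[𝕜] V) →ₗ[𝕜] (𝕜[X] ⊗[𝕜] V) :=
  TensorProduct.map₂ (LinearMap.mul 𝕜 𝕜[X]) X.bracket

/-- The derivative with respect to `t` on `𝕜[t] ⊗ V`. -/
def polyDeriv (𝕜 : Type*) [Field 𝕜] (V : Type*) [AddCommGroup V] [Module 𝕜 V] :
    (𝕜[X] ⊗[𝕜] V) →ₗ[𝕜] (𝕜[X] ⊗[𝕜] V) :=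
  (Polynomial.derivative : 𝕜[X] →ₗ[𝕜] 𝕜[X]).rTensor V

@[simp] theorem polyBracket_tmul (X : DGLA 𝕜 V) (p q : 𝕜[X]) (v w : V) :
    X.polyBracket (p ⊗ₜ v) (q ⊗ₜ w) = (p * q) ⊗ₜ X.bracket v w := by
  simp [polyBracket]

@[elab_as_elim]
theorem lTensor_deg_induction (G : Grading 𝕜 V) {U : Type*} [AddCommGroup U] [Module 𝕜 U]
    {i : ℤ} {P : U ⊗[𝕜] V → Prop} {x : U ⊗[𝕜] V} (hx : x ∈ (G.lTensor U).deg i)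
    (h0 : P 0) (ht : ∀ u, ∀ v ∈ G.deg i, P (u ⊗ₜ v)) (hadd : ∀ x y, P x → P y → P (x + y)) :
    P x := by
  obtain ⟨y, rfl⟩ := hx
  induction y using TensorProduct.induction_on with
  | zero => simpa using h0
  | tmul u v => exact ht u v v.2
  | add y z hy hz => rw [map_add]; exact hadd _ _ hy hz

theorem tmul_mem_lTensor_deg (G : Grading 𝕜 V) {U : Type*} [AddCommGroup U] [Module 𝕜 U]
    {i : ℤ} (u : U) {v : V} (hv : v ∈ G.deg i) : u ⊗ₜ v ∈ (G.lTensor U).deg i :=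
  ⟨u ⊗ₜ ⟨v, hv⟩, by simp⟩

theorem polyBracket_mem (X : DGLA 𝕜 V) (i j : ℤ) (x : 𝕜[X] ⊗[𝕜] V)
    (hx : x ∈ (X.lTensor 𝕜[X]).deg i) (y : 𝕜[X] ⊗[𝕜] V) (hy : y ∈ (X.lTensor 𝕜[X]).deg j) :
    X.polyBracket x y ∈ (X.lTensor 𝕜[X]).deg (i + j) := by
  refine lTensor_deg_induction _ hx (by simp) (fun p v hv => ?_) (fun x x' h h' => ?_)
  · refine lTensor_deg_induction _ hy (by simp) (fun q w hw => ?_) (fun x x' h h' => ?_)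
    · rw [polyBracket_tmul]
      exact tmul_mem_lTensor_deg _ _ (X.bracket_mem i j v hv w hw)
    · rw [map_add]; exact add_mem h h'
  · rw [map_add, LinearMap.add_apply]; exact add_mem h h'

theorem polyBracket_skew (X : DGLA 𝕜 V) (i j : ℤ) (x : 𝕜[X] ⊗[𝕜] V)
    (hx : x ∈ (X.lTensor 𝕜[X]).deg i) (y : 𝕜[X] ⊗[𝕜] V) (hy : y ∈ (X.lTensor 𝕜[X]).deg j) :
    X.polyBracket x y = -((-1 : 𝕜) ^ (i * j) • X.polyBracket y x) := by
  refine lTensor_deg_induction _ hx (by simp) (fun p v hv => ?_) (fun x x' h h' => ?_)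
  · refine lTensor_deg_induction _ hy (by simp) (fun q w hw => ?_) (fun x x' h h' => ?_)
    · rw [polyBracket_tmul, polyBracket_tmul, X.skew i j v hv w hw, mul_comm q p,
        TensorProduct.tmul_neg, TensorProduct.tmul_smul]
    · simp only [map_add, LinearMap.add_apply, h, h', smul_add]; abel
  · simp only [map_add, LinearMap.add_apply, h, h', smul_add]; abel

theorem polyBracket_jacobi (X : DGLA 𝕜 V) (i j k : ℤ) (x : 𝕜[X] ⊗[𝕜] V)
    (hx : x ∈ (X.lTensor 𝕜[X]).deg i) (y : 𝕜[X] ⊗[𝕜] V) (hy : y ∈ (X.lTensor 𝕜[X]).deg j)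
    (z : 𝕜[X] ⊗[𝕜] V) (hz : z ∈ (X.lTensor 𝕜[X]).deg k) :
    X.polyBracket x (X.polyBracket y z) = X.polyBracket (X.polyBracket x y) z
      + (-1 : 𝕜) ^ (i * j) • X.polyBracket y (X.polyBracket x z) := by
  refine lTensor_deg_induction _ hx (by simp) (fun p u hu => ?_) (fun x x' h h' => ?_)
  · refine lTensor_deg_induction _ hy (by simp) (fun q v hv => ?_) (fun x x' h h' => ?_)
    · refine lTensor_deg_induction _ hz (by simp) (fun r w hw => ?_) (fun x x' h h' => ?_)
      · simp only [polyBracket_tmul]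
        rw [X.jacobi i j k u hu v hv w hw, TensorProduct.tmul_add, mul_assoc, mul_left_comm q p r,
          TensorProduct.tmul_smul]
      · simp only [map_add, h, h', smul_add]; abel
    · simp only [map_add, LinearMap.add_apply, h, h', smul_add]; abel
  · simp only [map_add, LinearMap.add_apply, h, h', smul_add]; abel

theorem polyBracket_leibniz (X : DGLA 𝕜 V) (i j : ℤ) (x : 𝕜[X] ⊗[𝕜] V)
    (hx : x ∈ (X.lTensor 𝕜[X]).deg i) (y : 𝕜[X] ⊗[𝕜] V) (hy : y ∈ (X.lTensor 𝕜[X]).deg j) :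
    X.d.lTensor 𝕜[X] (X.polyBracket x y) = X.polyBracket (X.d.lTensor 𝕜[X] x) y
      + (-1 : 𝕜) ^ i • X.polyBracket x (X.d.lTensor 𝕜[X] y) := by
  refine lTensor_deg_induction _ hx (by simp) (fun p v hv => ?_) (fun x x' h h' => ?_)
  · refine lTensor_deg_induction _ hy (by simp) (fun q w hw => ?_) (fun x x' h h' => ?_)
    · simp only [polyBracket_tmul, LinearMap.lTensor_tmul]
      rw [X.leibniz i j v hv w hw, TensorProduct.tmul_add, TensorProduct.tmul_smul]
    · simp only [map_add, h, h', smul_add]; abel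
  · simp only [map_add, LinearMap.add_apply, h, h', smul_add]; abel

theorem polyDeriv_polyBracket (X : DGLA 𝕜 V) (x y : 𝕜[X] ⊗[𝕜] V) :
    polyDeriv 𝕜 V (X.polyBracket x y) = X.polyBracket (polyDeriv 𝕜 V x) y
      + X.polyBracket x (polyDeriv 𝕜 V y) := by
  induction x using TensorProduct.induction_on with
  | zero => simp
  | tmul p v =>
    induction y using TensorProduct.induction_on with
    | zero => simp
    | tmul q w => simp [polyDeriv, TensorProduct.add_tmul]
    | add y z hy hz => simp only [map_add, hy, hz]; abel
  | add y z hy hz => simp only [map_add, LinearMap.add_apply, hy, hz]; abel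

theorem lTensor_d_d (X : DGLA 𝕜 V) (x : 𝕜[X] ⊗[𝕜] V) :
    X.d.lTensor 𝕜[X] (X.d.lTensor 𝕜[X] x) = 0 := by
  rw [← LinearMap.comp_apply, ← LinearMap.lTensor_comp]
  have : X.d ∘ₗ X.d = 0 := LinearMap.ext X.d_d
  rw [this]; simp

theorem lTensor_d_polyDeriv (X : DGLA 𝕜 V) (x : 𝕜[X] ⊗[𝕜] V) :
    X.d.lTensor 𝕜[X] (polyDeriv 𝕜 V x) = polyDeriv 𝕜 V (X.d.lTensor 𝕜[X] x) := by
  induction x using TensorProduct.induction_on with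
  | zero => simp
  | tmul p v => simp [polyDeriv]
  | add y z hy hz => simp only [map_add, hy, hz]

theorem lTensor_d_mem (X : DGLA 𝕜 V) (i : ℤ) (x : 𝕜[X] ⊗[𝕜] V)
    (hx : x ∈ (X.lTensor 𝕜[X]).deg i) :
    X.d.lTensor 𝕜[X] x ∈ (X.lTensor 𝕜[X]).deg (i + 1) := by
  refine lTensor_deg_induction _ hx (by simp) (fun p u hu => ?_) (fun x x' h h' => ?_)
  · exact tmul_mem_lTensor_deg _ _ (X.d_mem i u hu)
  · rw [map_add]; exact add_mem h h'

theorem polyDeriv_mem (X : DGLA 𝕜 V) (i : ℤ) (x : 𝕜[X] ⊗[𝕜] V)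
    (hx : x ∈ (X.lTensor 𝕜[X]).deg i) : polyDeriv 𝕜 V x ∈ (X.lTensor 𝕜[X]).deg i := by
  refine lTensor_deg_induction _ hx (by simp) (fun p u hu => ?_) (fun x x' h h' => ?_)
  · exact tmul_mem_lTensor_deg _ _ hu
  · rw [map_add]; exact add_mem h h'

theorem neg_one_zpow_mul_self (i : ℤ) : (-1 : 𝕜) ^ i * (-1 : 𝕜) ^ i = 1 := by
  rw [← mul_zpow]; simp

theorem neg_one_zpow_sub_one (i : ℤ) : (-1 : 𝕜) ^ (i - 1) = -(-1 : 𝕜) ^ i := by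
  rw [zpow_sub₀ (by simp)]; simp [div_neg]

theorem neg_one_zpow_add_one (i : ℤ) : (-1 : 𝕜) ^ (i + 1) = -(-1 : 𝕜) ^ i := by
  rw [zpow_add₀ (by simp)]; simp

/-- The differential graded Lie algebra `V[t, dt]` of polynomial differential forms on the affine
line with values in `V`. The pair `(p, q)` stands for the form `p(t) + dt q(t)`. Thus
`d (p + dt q) = dp + dt (∂p/∂t - dq)` and
`[p + dt q, p' + dt q'] = [p, p'] + dt ([q, p'] + (-1)^(deg p) [p, q'])`. -/
def polyForms (X : DGLA 𝕜 V) : DGLA 𝕜 ((𝕜[X] ⊗[𝕜] V) × (𝕜[X] ⊗[𝕜] V)) where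
  toGrading := (X.lTensor 𝕜[X]).prod (X.lTensor 𝕜[X]).shift
  d := LinearMap.prod (X.d.lTensor 𝕜[X] ∘ₗ LinearMap.fst 𝕜 _ _)
    (polyDeriv 𝕜 V ∘ₗ LinearMap.fst 𝕜 _ _ - X.d.lTensor 𝕜[X] ∘ₗ LinearMap.snd 𝕜 _ _)
  bracket := LinearMap.mk₂ 𝕜 (fun x y => (X.polyBracket x.1 y.1,
      X.polyBracket x.2 y.1 + X.polyBracket ((X.lTensor 𝕜[X]).sgn x.1) y.2))
    (by intros; ext <;> simp; abel) (by intros; ext <;> simp)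
    (by intros; ext <;> simp; abel) (by intros; ext <;> simp)
  d_mem i v hv := by
    refine ⟨X.lTensor_d_mem i _ hv.1, ?_⟩
    change _ ∈ (X.lTensor 𝕜[X]).deg (i + 1 - 1)
    have h := X.lTensor_d_mem (i - 1) _ hv.2
    rw [show i - 1 + 1 = i by ring] at h
    rw [show i + 1 - 1 = i by ring]
    exact sub_mem (X.polyDeriv_mem i _ hv.1) h
  d_d v := by
    ext
    · exact X.lTensor_d_d _
    · simp [lTensor_d_d, lTensor_d_polyDeriv]
  bracket_mem i j v hv w hw := by
    refine ⟨X.polyBracket_mem i j _ hv.1 _ hw.1, ?_⟩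
    change _ ∈ (X.lTensor 𝕜[X]).deg (i + j - 1)
    have h1 := X.polyBracket_mem (i - 1) j _ hv.2 _ hw.1
    have h2 := X.polyBracket_mem i (j - 1) _ hv.1 _ hw.2
    rw [show i - 1 + j = i + j - 1 by ring] at h1
    rw [show i + (j - 1) = i + j - 1 by ring] at h2
    simp only [LinearMap.mk₂_apply, Grading.sgn_of_mem _ hv.1, map_smul, LinearMap.smul_apply]
    exact add_mem h1 (Submodule.smul_mem _ _ h2)
  skew i j v hv w hw := by
    ext
    · exact X.polyBracket_skew i j _ hv.1 _ hw.1
    · have h1 := X.polyBracket_skew (i - 1) j _ hv.2 _ hw.1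
      have h2 := X.polyBracket_skew i (j - 1) _ hv.1 _ hw.2
      simp only [LinearMap.mk₂_apply, Grading.sgn_of_mem _ hv.1, Grading.sgn_of_mem _ hw.1,
        map_smul, LinearMap.smul_apply, Prod.snd_neg, Prod.smul_snd, h1, h2]
      rw [sub_mul, mul_sub, zpow_sub₀ (by simp), zpow_sub₀ (by simp), one_mul, mul_one,
        div_eq_mul_inv, div_eq_mul_inv, ← inv_zpow, ← inv_zpow, inv_neg_one]
      simp only [smul_add, smul_neg, smul_smul, mul_left_comm ((-1 : 𝕜) ^ i),
        neg_one_zpow_mul_self, mul_one]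
      module
  jacobi i j k u hu v hv w hw := by
    ext
    · exact X.polyBracket_jacobi i j k _ hu.1 _ hv.1 _ hw.1
    · have h1 := X.polyBracket_jacobi (i - 1) j k _ hu.2 _ hv.1 _ hw.1
      have h2 := X.polyBracket_jacobi i (j - 1) k _ hu.1 _ hv.2 _ hw.1
      have h3 := X.polyBracket_jacobi i j (k - 1) _ hu.1 _ hv.1 _ hw.2
      simp only [LinearMap.mk₂_apply, Grading.sgn_of_mem _ hu.1, Grading.sgn_of_mem _ hv.1,
        Grading.sgn_of_mem _ (X.polyBracket_mem i j _ hu.1 _ hv.1), map_add, LinearMap.add_apply,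
        map_smul, LinearMap.smul_apply, Prod.snd_add, Prod.smul_snd, h1, h2, h3]
      rw [sub_mul, mul_sub, zpow_sub₀ (by simp), zpow_sub₀ (by simp), one_mul, mul_one,
        div_eq_mul_inv, div_eq_mul_inv, ← inv_zpow, ← inv_zpow, inv_neg_one,
        zpow_add₀ (by simp) i j]
      simp only [smul_add, smul_smul, mul_left_comm ((-1 : 𝕜) ^ i), neg_one_zpow_mul_self, mul_one]
      module
  leibniz i j v hv w hw := by
    ext
    · exact X.polyBracket_leibniz i j _ hv.1 _ hw.1
    · have h1 := X.polyBracket_leibniz (i - 1) j _ hv.2 _ hw.1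
      have h2 := X.polyBracket_leibniz i (j - 1) _ hv.1 _ hw.2
      change polyDeriv 𝕜 V (X.polyBracket v.1 w.1) - X.d.lTensor 𝕜[X] (X.polyBracket v.2 w.1
          + X.polyBracket ((X.lTensor 𝕜[X]).sgn v.1) w.2)
        = X.polyBracket (polyDeriv 𝕜 V v.1 - X.d.lTensor 𝕜[X] v.2) w.1
          + X.polyBracket ((X.lTensor 𝕜[X]).sgn (X.d.lTensor 𝕜[X] v.1)) w.2
          + (-1 : 𝕜) ^ i • (X.polyBracket v.2 (X.d.lTensor 𝕜[X] w.1)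
            + X.polyBracket ((X.lTensor 𝕜[X]).sgn v.1)
              (polyDeriv 𝕜 V w.1 - X.d.lTensor 𝕜[X] w.2))
      simp only [Grading.sgn_of_mem _ hv.1,
        Grading.sgn_of_mem _ (X.lTensor_d_mem i _ hv.1), map_add, map_sub,
        LinearMap.sub_apply, polyDeriv_polyBracket,
        map_smul, LinearMap.smul_apply, h1, h2, smul_add, smul_sub, smul_smul, neg_smul,
        map_neg, LinearMap.neg_apply,
        neg_one_zpow_mul_self, one_smul, neg_one_zpow_sub_one, neg_one_zpow_add_one]
      module

/-- The evaluation `p(t) ↦ p(a)` on `𝕜[t] ⊗ V`. -/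
def polyEval (V : Type*) [AddCommGroup V] [Module 𝕜 V] (a : 𝕜) : (𝕜[X] ⊗[𝕜] V) →ₗ[𝕜] V :=
  (TensorProduct.lid 𝕜 V : 𝕜 ⊗[𝕜] V →ₗ[𝕜] V) ∘ₗ (Polynomial.leval a).rTensor V

@[simp] theorem polyEval_tmul (a : 𝕜) (p : 𝕜[X]) (v : V) :
    polyEval V a (p ⊗ₜ v) = p.eval a • v := by
  simp [polyEval]

/-- The evaluation morphism `p(t) + dt q(t) ↦ p(a)` from `V[t, dt]` to `V`. -/
def evalHom (X : DGLA 𝕜 V) (a : 𝕜) : X.polyForms.Hom X where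
  toLin := polyEval V a ∘ₗ LinearMap.fst 𝕜 _ _
  map_mem i v hv := by
    refine lTensor_deg_induction _ hv.1 (P := fun x => polyEval V a x ∈ X.deg i) (by simp)
      (fun p u hu => ?_) (fun x x' h h' => ?_)
    · rw [polyEval_tmul]; exact Submodule.smul_mem _ _ hu
    · rw [map_add]; exact add_mem h h'
  map_d v := by
    change polyEval V a (X.d.lTensor 𝕜[X] v.1) = X.d (polyEval V a v.1)
    induction v.1 using TensorProduct.induction_on with
    | zero => simp
    | tmul p u => simp
    | add x y hx hy => simp only [map_add, hx, hy]
  map_bracket v w := by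
    change polyEval V a (X.polyBracket v.1 w.1) =
      X.bracket (polyEval V a v.1) (polyEval V a w.1)
    induction v.1 using TensorProduct.induction_on with
    | zero => simp
    | tmul p u =>
      induction w.1 using TensorProduct.induction_on with
      | zero => simp
      | tmul q u' => simp [smul_smul, mul_comm]
      | add x y hx hy => simp only [map_add, hx, hy]
    | add x y hx hy => simp only [map_add, LinearMap.add_apply, hx, hy]

end DGLA

/-- The primitive `p ↦ ∫₀ᵗ p(s) ds` of polynomials. -/
def primitive (𝕜 : Type*) [Field 𝕜] : 𝕜[X] →ₗ[𝕜] 𝕜[X] :=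
  Polynomial.lsum fun i => ((i : 𝕜) + 1)⁻¹ • Polynomial.monomial (i + 1)

theorem primitive_monomial {𝕜 : Type*} [Field 𝕜] (i : ℕ) (a : 𝕜) :
    primitive 𝕜 (Polynomial.monomial i a) = Polynomial.monomial (i + 1) (((i : 𝕜) + 1)⁻¹ * a) := by
  simp [primitive, Polynomial.lsum_apply, Polynomial.smul_monomial]

theorem derivative_primitive {𝕜 : Type*} [Field 𝕜] [CharZero 𝕜] (p : 𝕜[X]) :
    Polynomial.derivative (primitive 𝕜 p) = p := by
  induction p using Polynomial.induction_on' with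
  | add p q hp hq => simp [hp, hq]
  | monomial n a =>
    have : (n : 𝕜) + 1 ≠ 0 := by exact_mod_cast n.succ_ne_zero
    rw [primitive_monomial, Polynomial.derivative_monomial]
    congr 1
    push_cast
    field_simp

theorem primitive_derivative {𝕜 : Type*} [Field 𝕜] [CharZero 𝕜] (p : 𝕜[X]) :
    primitive 𝕜 (Polynomial.derivative p) = p - Polynomial.C (p.eval 0) := by
  induction p using Polynomial.induction_on' with
  | add p q hp hq => simp only [map_add, hp, hq, Polynomial.eval_add]; ring
  | monomial n a =>
    rw [Polynomial.derivative_monomial, primitive_monomial]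
    rcases n with _ | n
    · simp [Polynomial.monomial_zero_left]
    · have : (n : 𝕜) + 1 ≠ 0 := by exact_mod_cast n.succ_ne_zero
      simp only [Nat.add_sub_cancel, Polynomial.eval_monomial]
      rw [zero_pow (Nat.succ_ne_zero n), mul_zero, map_zero, sub_zero]
      congr 1
      push_cast
      field_simp

theorem eval_zero_primitive {𝕜 : Type*} [Field 𝕜] (p : 𝕜[X]) :
    (primitive 𝕜 p).eval 0 = 0 := by
  induction p using Polynomial.induction_on' with
  | add p q hp hq => simp [hp, hq]
  | monomial n a => simp [primitive_monomial]

/-- The operation `q₂(v ⊙ w) = (-1)^(deg v) [v, w]` on the suspension. -/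
def DGLA.q₂ {𝕜 : Type*} [Field 𝕜] {V : Type*} [AddCommGroup V] [Module 𝕜 V] (X : DGLA 𝕜 V) :
    V →ₗ[𝕜] V →ₗ[𝕜] V := X.bracket ∘ₗ X.sgn

/-- Given a differential graded Lie algebra `V` and a complex `(C, D)`: homotopy inverse morphisms
of complexes `ι : C → V` and `π : V → C` with `π ι = id`, and a homotopy `K` of degree `-1` with
`id - ι π = K q₁ + q₁ K`, where `q₁ = -d` is the suspended differential, such that
`q₂(Im K ⊗ Im K)` lies in `ker π ∩ ker K`. -/
structure Contraction {𝕜 : Type*} [Field 𝕜] {V C : Type*} [AddCommGroup V] [Module 𝕜 V]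
    [AddCommGroup C] [Module 𝕜 C] (X : DGLA 𝕜 V) (G : Grading 𝕜 C) (D : C →ₗ[𝕜] C) where
  ι : C →ₗ[𝕜] V
  π : V →ₗ[𝕜] C
  K : V →ₗ[𝕜] V
  ι_mem : ∀ i, ∀ c ∈ G.deg i, ι c ∈ X.deg i
  π_mem : ∀ i, ∀ v ∈ X.deg i, π v ∈ G.deg i
  K_mem : ∀ i, ∀ v ∈ X.deg i, K v ∈ X.deg (i - 1)
  ι_D : ∀ c, ι (D c) = X.d (ι c)
  π_d : ∀ v, π (X.d v) = D (π v)
  π_ι : ∀ c, π (ι c) = c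
  homotopy : ∀ v, v - ι (π v) = K (-X.d v) + -X.d (K v)
  π_q₂ : ∀ v w, π (X.q₂ (K v) (K w)) = 0
  K_q₂ : ∀ v w, K (X.q₂ (K v) (K w)) = 0

/-- The multilinear map `(γ₀, …, γₙ) ↦ B (γ₀, T (γ₁, …, γₙ))`. -/
def consMap {𝕜 : Type*} [Field 𝕜] {C V U : Type*} [AddCommGroup C] [Module 𝕜 C]
    [AddCommGroup V] [Module 𝕜 V] [AddCommGroup U] [Module 𝕜 U] {n : ℕ}
    (B : C →ₗ[𝕜] V →ₗ[𝕜] U) (T : MultilinearMap 𝕜 (fun _ : Fin n => C) V) :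
    MultilinearMap 𝕜 (fun _ : Fin (n + 1) => C) U :=
  LinearMap.uncurryLeft
    { toFun := fun c => (B c).compMultilinearMap T
      map_add' := fun c c' => by ext; simp
      map_smul' := fun a c => by ext; simp }

@[simp] theorem consMap_apply {𝕜 : Type*} [Field 𝕜] {C V U : Type*} [AddCommGroup C] [Module 𝕜 C]
    [AddCommGroup V] [Module 𝕜 V] [AddCommGroup U] [Module 𝕜 U] {n : ℕ}
    (B : C →ₗ[𝕜] V →ₗ[𝕜] U) (T : MultilinearMap 𝕜 (fun _ : Fin n => C) V)
    (γ : Fin (n + 1) → C) : consMap B T γ = B (γ 0) (T (Fin.tail γ)) := rfl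

/-- The Koszul sign `ε(σ; v₁, …, vₙ)` of homogeneous vectors whose degrees have the parities
`e₁, …, eₙ`: one factor `(-1)^(deg v_{σ(i)} deg v_{σ(j)})` for each inversion of `σ`. -/
def koszulSign (𝕜 : Type*) [Field 𝕜] {n : ℕ} (σ : Equiv.Perm (Fin n)) (e : Fin n → ZMod 2) : 𝕜 :=
  ∏ i, ∏ j, if i < j ∧ σ j < σ i then (-1) ^ ((e (σ i)).val * (e (σ j)).val) else 1

namespace Contraction

variable {𝕜 : Type*} [Field 𝕜] {V C : Type*} [AddCommGroup V] [Module 𝕜 V]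
    [AddCommGroup C] [Module 𝕜 C] {X : DGLA 𝕜 V} {G : Grading 𝕜 C} {D : C →ₗ[𝕜] C}

/-- The nested expression `K q₂(ι γ₀ ⊙ K q₂(ι γ₁ ⊙ ⋯ K q₂(ι γₙ₋₁ ⊙ ι γₙ)))`. -/
def nested (T : Contraction X G D) : (n : ℕ) → MultilinearMap 𝕜 (fun _ : Fin (n + 1) => C) V
  | 0 => MultilinearMap.ofSubsingleton 𝕜 C V (0 : Fin 1) T.ι
  | n + 1 => consMap ((X.q₂ ∘ₗ T.ι).compr₂ T.K) (T.nested n)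

/-- The expression `π q₂(ι γ₀ ⊙ K q₂(ι γ₁ ⊙ ⋯ K q₂(ι γₙ ⊙ ι γₙ₊₁)))`. -/
def tree (T : Contraction X G D) (n : ℕ) : MultilinearMap 𝕜 (fun _ : Fin (n + 2) => C) C :=
  consMap ((X.q₂ ∘ₗ T.ι).compr₂ T.π) (T.nested n)

/-- The higher brackets `⟨γ₁ ⊙ ⋯ ⊙ γₙ⟩ₙ` on the suspension of `C` that are obtained by homotopy
transfer: `⟨γ⟩₁ = -Dγ` and, for `n ≥ 2`,
`⟨γ₁ ⊙ ⋯ ⊙ γₙ⟩ₙ = (-1)ⁿ⁻² / 2 ∑_σ ε(σ) π q₂(ι γ_{σ(1)} ⊙ K q₂(ι γ_{σ(2)} ⊙ ⋯))`.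
The inner sum below decomposes each `γᵢ` into its part of even and its part of odd degree in the
suspension, where the Koszul sign is defined (even degree in the suspension is odd degree
in `C`). -/
def bracket (T : Contraction X G D) : (n : ℕ) → MultilinearMap 𝕜 (fun _ : Fin n => C) C
  | 0 => 0
  | 1 => MultilinearMap.ofSubsingleton 𝕜 C C (0 : Fin 1) (-D)
  | n + 2 => ((-1 : 𝕜) ^ n / 2) • ∑ σ : Equiv.Perm (Fin (n + 2)), ∑ e : Fin (n + 2) → ZMod 2,
      koszulSign 𝕜 σ e •
        ((T.tree n).domDomCongr σ).compLinearMap fun i => G.parityProj (e i + 1)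

end Contraction

section Cone

variable {𝕜 : Type*} [Field 𝕜] {L N M : Type*} [AddCommGroup L] [Module 𝕜 L]
  [AddCommGroup N] [Module 𝕜 N] [AddCommGroup M] [Module 𝕜 M]
  {X : DGLA 𝕜 L} {Y : DGLA 𝕜 N} {Z : DGLA 𝕜 M}

/-- The grading `Cⁱ = Lⁱ ⊕ Nⁱ ⊕ Mⁱ⁻¹` of the cone of a pair of morphisms `L → M ← N`. -/
def coneGrading (X : DGLA 𝕜 L) (Y : DGLA 𝕜 N) (Z : DGLA 𝕜 M) : Grading 𝕜 (L × N × M) :=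
  X.toGrading.prod (Y.toGrading.prod Z.toGrading.shift)

/-- The differential `D (l, n, m) = (d l, d n, -d m - g n + h l)` of the cone. -/
def coneD (h : X.Hom Z) (g : Y.Hom Z) : (L × N × M) →ₗ[𝕜] (L × N × M) where
  toFun c := (X.d c.1, Y.d c.2.1, -Z.d c.2.2 - g.toLin c.2.1 + h.toLin c.1)
  map_add' c c' := by
    ext <;> simp
    abel
  map_smul' a c := by
    ext <;> simp [smul_sub]

/-- The subspace of those `(l, n, m(t, dt))` in `L × N × M[t, dt]` with `h l = m(1)` and
`g n = m(0)`. -/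
def pathSubmodule (h : X.Hom Z) (g : Y.Hom Z) :
    Submodule 𝕜 (L × N × ((𝕜[X] ⊗[𝕜] M) × (𝕜[X] ⊗[𝕜] M))) where
  carrier := {x | h.toLin x.1 = (Z.evalHom 1).toLin x.2.2 ∧
    g.toLin x.2.1 = (Z.evalHom 0).toLin x.2.2}
  add_mem' hx hy := by
    constructor
    · simpa only [Prod.fst_add, Prod.snd_add, map_add] using congrArg₂ (· + ·) hx.1 hy.1
    · simpa only [Prod.fst_add, Prod.snd_add, map_add] using congrArg₂ (· + ·) hx.2 hy.2
  zero_mem' := by simp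
  smul_mem' a x hx := by
    constructor
    · simpa only [Prod.smul_fst, Prod.smul_snd, map_smul] using congrArg (a • ·) hx.1
    · simpa only [Prod.smul_fst, Prod.smul_snd, map_smul] using congrArg (a • ·) hx.2

/-- The differential graded Lie algebra `H_(h,g)` associated with the pair `(h, g)`. -/
def pathDGLA (h : X.Hom Z) (g : Y.Hom Z) : DGLA 𝕜 (pathSubmodule h g) :=
  (X.prod (Y.prod Z.polyForms)).restrict (pathSubmodule h g)
    (fun i v hv => by
      have e1 : ((X.prod (Y.prod Z.polyForms)).proj i v).1 = X.proj i v.1 :=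
        Grading.map_scale (X.prod (Y.prod Z.polyForms)).toGrading X.toGrading (LinearMap.fst 𝕜 _ _)
          (fun i v hv => hv.1) _ v
      have e2 : ((X.prod (Y.prod Z.polyForms)).proj i v).2.1 = Y.proj i v.2.1 :=
        Grading.map_scale (X.prod (Y.prod Z.polyForms)).toGrading Y.toGrading (LinearMap.fst 𝕜 _ _ ∘ₗ LinearMap.snd 𝕜 _ _)
          (fun i v hv => hv.2.1) _ v
      have e3 : ((X.prod (Y.prod Z.polyForms)).proj i v).2.2 = Z.polyForms.proj i v.2.2 :=
        Grading.map_scale (X.prod (Y.prod Z.polyForms)).toGrading Z.polyForms.toGrading (LinearMap.snd 𝕜 _ _ ∘ₗ LinearMap.snd 𝕜 _ _)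
          (fun i v hv => hv.2.2) _ v
      constructor
      · rw [e1, e3]
        exact (Grading.map_scale X.toGrading Z.toGrading _ h.map_mem _ _).trans
          ((congrArg _ hv.1).trans (Grading.map_scale Z.polyForms.toGrading Z.toGrading _
            (Z.evalHom 1).map_mem _ _).symm)
      · rw [e2, e3]
        exact (Grading.map_scale Y.toGrading Z.toGrading _ g.map_mem _ _).trans
          ((congrArg _ hv.2).trans (Grading.map_scale Z.polyForms.toGrading Z.toGrading _
            (Z.evalHom 0).map_mem _ _).symm))
    (fun v hv => by
      constructor
      · change h.toLin (X.d v.1) = (Z.evalHom 1).toLin (Z.polyForms.d v.2.2)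
        rw [h.map_d, (Z.evalHom 1).map_d, hv.1]
      · change g.toLin (Y.d v.2.1) = (Z.evalHom 0).toLin (Z.polyForms.d v.2.2)
        rw [g.map_d, (Z.evalHom 0).map_d, hv.2])
    (fun v hv w hw => by
      constructor
      · change h.toLin (X.bracket v.1 w.1) =
          (Z.evalHom 1).toLin (Z.polyForms.bracket v.2.2 w.2.2)
        rw [h.map_bracket, (Z.evalHom 1).map_bracket, hv.1, hw.1]
      · change g.toLin (Y.bracket v.2.1 w.2.1) =
          (Z.evalHom 0).toLin (Z.polyForms.bracket v.2.2 w.2.2)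
        rw [g.map_bracket, (Z.evalHom 0).map_bracket, hv.2, hw.2])

/-- `ι (l, n, m) = (l, n, (1 - t) g(n) + t h(l) + dt m)`. -/
def pathι (h : X.Hom Z) (g : Y.Hom Z) : (L × N × M) →ₗ[𝕜] pathSubmodule h g where
  toFun c := ⟨(c.1, c.2.1, ((1 - Polynomial.X) ⊗ₜ g.toLin c.2.1 + Polynomial.X ⊗ₜ h.toLin c.1,
      1 ⊗ₜ c.2.2)), by
    constructor
    · simp [DGLA.evalHom]
    · simp [DGLA.evalHom]⟩
  map_add' c c' := by
    ext <;> simp [TensorProduct.tmul_add]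
    abel
  map_smul' a c := by
    ext <;> simp [TensorProduct.tmul_smul]

/-- The integral `∫₀ᵗ q(s) ds` on `𝕜[t] ⊗ M`. -/
def polyPrimitive (𝕜 : Type*) [Field 𝕜] (M : Type*) [AddCommGroup M] [Module 𝕜 M] :
    (𝕜[X] ⊗[𝕜] M) →ₗ[𝕜] (𝕜[X] ⊗[𝕜] M) := (primitive 𝕜).rTensor M

/-- The integral `∫₀¹ (p(t) + dt q(t)) = ∫₀¹ q(t) dt` from `M[t, dt]` to `M`. -/
def integral (𝕜 : Type*) [Field 𝕜] (M : Type*) [AddCommGroup M] [Module 𝕜 M] :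
    ((𝕜[X] ⊗[𝕜] M) × (𝕜[X] ⊗[𝕜] M)) →ₗ[𝕜] M :=
  DGLA.polyEval M (1 : 𝕜) ∘ₗ polyPrimitive 𝕜 M ∘ₗ LinearMap.snd 𝕜 _ _

/-- `π (l, n, m(t, dt)) = (l, n, ∫₀¹ m(t, dt))`. -/
def pathπ (h : X.Hom Z) (g : Y.Hom Z) : pathSubmodule h g →ₗ[𝕜] (L × N × M) :=
  (LinearMap.id.prodMap (LinearMap.id.prodMap (integral 𝕜 M))) ∘ₗ (pathSubmodule h g).subtype

theorem polyEval_zero_primitive (x : 𝕜[X] ⊗[𝕜] M) :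
    DGLA.polyEval M (0 : 𝕜) (polyPrimitive 𝕜 M x) = 0 := by
  induction x using TensorProduct.induction_on with
  | zero => simp
  | tmul p v => simp [polyPrimitive, eval_zero_primitive]
  | add x y hx hy => simp [hx, hy]

/-- `K (l, n, m(t, dt)) = (0, 0, t ∫₀¹ m(t, dt) - ∫₀ᵗ m(s, ds))`. -/
def pathK (h : X.Hom Z) (g : Y.Hom Z) : pathSubmodule h g →ₗ[𝕜] pathSubmodule h g where
  toFun x := ⟨(0, 0, (Polynomial.X ⊗ₜ integral 𝕜 M x.1.2.2 - polyPrimitive 𝕜 M x.1.2.2.2, 0)), by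
    constructor
    · change _ = DGLA.polyEval M (1 : 𝕜) _
      simp [integral]
    · change _ = DGLA.polyEval M (0 : 𝕜) _
      simp [polyEval_zero_primitive]⟩
  map_add' x y := by
    ext <;> simp [TensorProduct.tmul_add]
    abel
  map_smul' a x := by
    ext <;> simp [smul_sub]

theorem polyEval_mem (Z : DGLA 𝕜 M) (a : 𝕜) (i : ℤ) (x : 𝕜[X] ⊗[𝕜] M)
    (hx : x ∈ (Z.lTensor 𝕜[X]).deg i) : DGLA.polyEval M a x ∈ Z.deg i := by
  refine DGLA.lTensor_deg_induction _ hx (by simp) (fun p v hv => ?_) (fun x y hx hy => ?_)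
  · rw [DGLA.polyEval_tmul]; exact Submodule.smul_mem _ _ hv
  · rw [map_add]; exact add_mem hx hy

theorem polyPrimitive_mem (Z : DGLA 𝕜 M) (i : ℤ) (x : 𝕜[X] ⊗[𝕜] M)
    (hx : x ∈ (Z.lTensor 𝕜[X]).deg i) : polyPrimitive 𝕜 M x ∈ (Z.lTensor 𝕜[X]).deg i := by
  refine DGLA.lTensor_deg_induction _ hx (by simp) (fun p v hv => ?_) (fun x y hx hy => ?_)
  · exact DGLA.tmul_mem_lTensor_deg _ _ hv
  · rw [map_add]; exact add_mem hx hy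

theorem polyPrimitive_lTensor (f : M →ₗ[𝕜] M) (x : 𝕜[X] ⊗[𝕜] M) :
    polyPrimitive 𝕜 M (f.lTensor 𝕜[X] x) = f.lTensor 𝕜[X] (polyPrimitive 𝕜 M x) := by
  induction x using TensorProduct.induction_on with
  | zero => simp
  | tmul p v => simp [polyPrimitive]
  | add x y hx hy => simp [hx, hy]

theorem polyEval_lTensor (f : M →ₗ[𝕜] M) (a : 𝕜) (x : 𝕜[X] ⊗[𝕜] M) :
    DGLA.polyEval M a (f.lTensor 𝕜[X] x) = f (DGLA.polyEval M a x) := by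
  induction x using TensorProduct.induction_on with
  | zero => simp
  | tmul p v => simp
  | add x y hx hy => simp [hx, hy]

theorem polyPrimitive_polyDeriv [CharZero 𝕜] (x : 𝕜[X] ⊗[𝕜] M) :
    polyPrimitive 𝕜 M (DGLA.polyDeriv 𝕜 M x) = x - 1 ⊗ₜ DGLA.polyEval M (0 : 𝕜) x := by
  induction x using TensorProduct.induction_on with
  | zero => simp
  | tmul p v =>
    simp only [polyPrimitive, DGLA.polyDeriv, LinearMap.rTensor_tmul, DGLA.polyEval_tmul,
      primitive_derivative, TensorProduct.sub_tmul, TensorProduct.tmul_smul]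
    rw [TensorProduct.smul_tmul', Polynomial.smul_eq_C_mul, mul_one]
  | add x y hx hy => simp only [map_add, hx, hy, TensorProduct.tmul_add]; abel

theorem polyDeriv_polyPrimitive [CharZero 𝕜] (x : 𝕜[X] ⊗[𝕜] M) :
    DGLA.polyDeriv 𝕜 M (polyPrimitive 𝕜 M x) = x := by
  induction x using TensorProduct.induction_on with
  | zero => simp
  | tmul p v => simp [polyPrimitive, DGLA.polyDeriv, derivative_primitive]
  | add x y hx hy => simp only [map_add, hx, hy]

theorem pathDGLA_q₂_pathK (h : X.Hom Z) (g : Y.Hom Z) (v w : pathSubmodule h g) :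
    ((pathDGLA h g).q₂ (pathK h g v) (pathK h g w)).1.1 = 0 ∧
    ((pathDGLA h g).q₂ (pathK h g v) (pathK h g w)).1.2.1 = 0 ∧
    ((pathDGLA h g).q₂ (pathK h g v) (pathK h g w)).1.2.2.2 = 0 := by
  have h3 : ((pathDGLA h g).sgn (pathK h g v)).1.2.2.2 = 0 := by
    have := Grading.map_scale (pathDGLA h g).toGrading (Z.lTensor 𝕜[X]).shift
      (LinearMap.snd 𝕜 _ _ ∘ₗ LinearMap.snd 𝕜 _ _ ∘ₗ LinearMap.snd 𝕜 _ _ ∘ₗ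
        (pathSubmodule h g).subtype) (fun i v hv => hv.2.2.2) (fun i => (-1) ^ i) (pathK h g v)
    exact this.trans (map_zero _)
  refine ⟨?_, ?_, ?_⟩
  · change X.bracket _ 0 = 0
    simp
  · change Y.bracket _ 0 = 0
    simp
  · change Z.polyBracket ((pathDGLA h g).sgn (pathK h g v)).1.2.2.2 _ + Z.polyBracket _ 0 = 0
    rw [h3]; simp

/-- The contraction of `H_(h,g)` to the cone of `(h, g)` given by `ι`, `π` and `K`. -/
def pathContraction [CharZero 𝕜] (h : X.Hom Z) (g : Y.Hom Z) :
    Contraction (pathDGLA h g) (coneGrading X Y Z) (coneD h g) where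
  ι := pathι h g
  π := pathπ h g
  K := pathK h g
  ι_mem i c hc := by
    refine ⟨hc.1, hc.2.1, add_mem ?_ ?_, ?_⟩
    · exact DGLA.tmul_mem_lTensor_deg _ _ (g.map_mem i _ hc.2.1)
    · exact DGLA.tmul_mem_lTensor_deg _ _ (h.map_mem i _ hc.1)
    · exact DGLA.tmul_mem_lTensor_deg Z.toGrading (i := i - 1) _ hc.2.2
  π_mem i v hv := by
    refine ⟨hv.1, hv.2.1, ?_⟩
    exact polyEval_mem Z 1 (i - 1) _ (polyPrimitive_mem Z (i - 1) _ hv.2.2.2)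
  K_mem i v hv := by
    refine ⟨zero_mem _, zero_mem _, sub_mem ?_ ?_, zero_mem _⟩
    · exact DGLA.tmul_mem_lTensor_deg Z.toGrading (i := i - 1) _
        (polyEval_mem Z 1 (i - 1) _ (polyPrimitive_mem Z (i - 1) _ hv.2.2.2))
    · exact polyPrimitive_mem Z (i - 1) _ hv.2.2.2
  ι_D c := by
    refine Subtype.ext (Prod.ext rfl (Prod.ext rfl (Prod.ext ?_ ?_)))
    · change (1 - Polynomial.X) ⊗ₜ g.toLin (Y.d c.2.1) + Polynomial.X ⊗ₜ h.toLin (X.d c.1)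
        = Z.d.lTensor 𝕜[X] ((1 - Polynomial.X) ⊗ₜ g.toLin c.2.1 + Polynomial.X ⊗ₜ h.toLin c.1)
      simp [h.map_d, g.map_d]
    · change (1 : 𝕜[X]) ⊗ₜ (-Z.d c.2.2 - g.toLin c.2.1 + h.toLin c.1)
        = DGLA.polyDeriv 𝕜 M
            ((1 - Polynomial.X) ⊗ₜ g.toLin c.2.1 + Polynomial.X ⊗ₜ h.toLin c.1)
          - Z.d.lTensor 𝕜[X] (1 ⊗ₜ c.2.2)
      simp [DGLA.polyDeriv, TensorProduct.tmul_add, TensorProduct.tmul_sub,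
        TensorProduct.neg_tmul, TensorProduct.tmul_neg]
      abel
  π_d v := by
    refine Prod.ext rfl (Prod.ext rfl ?_)
    change DGLA.polyEval M (1 : 𝕜) (polyPrimitive 𝕜 M
        (DGLA.polyDeriv 𝕜 M v.1.2.2.1 - Z.d.lTensor 𝕜[X] v.1.2.2.2))
      = -Z.d (DGLA.polyEval M 1 (polyPrimitive 𝕜 M v.1.2.2.2)) - g.toLin v.1.2.1 + h.toLin v.1.1
    have h1 : h.toLin v.1.1 = DGLA.polyEval M 1 v.1.2.2.1 := v.2.1
    have h0 : g.toLin v.1.2.1 = DGLA.polyEval M 0 v.1.2.2.1 := v.2.2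
    rw [h1, h0, map_sub, map_sub, polyPrimitive_polyDeriv, polyPrimitive_lTensor,
      polyEval_lTensor]
    simp
    abel
  π_ι c := by
    refine Prod.ext rfl (Prod.ext rfl ?_)
    change DGLA.polyEval M (1 : 𝕜) (polyPrimitive 𝕜 M (1 ⊗ₜ c.2.2)) = c.2.2
    have : primitive 𝕜 1 = Polynomial.X := by
      rw [← Polynomial.C_1, ← Polynomial.monomial_zero_left, primitive_monomial]
      simp [Polynomial.monomial_one_one_eq_X]
    simp [polyPrimitive, this]
  homotopy v := by
    have h1 : h.toLin v.1.1 = DGLA.polyEval M 1 v.1.2.2.1 := v.2.1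
    have h0 : g.toLin v.1.2.1 = DGLA.polyEval M 0 v.1.2.2.1 := v.2.2
    refine Subtype.ext (Prod.ext ?_ (Prod.ext ?_ (Prod.ext ?_ ?_)))
    · change v.1.1 - v.1.1 = 0 + -X.d 0
      simp
    · change v.1.2.1 - v.1.2.1 = 0 + -Y.d 0
      simp
    · change v.1.2.2.1 - ((1 - Polynomial.X) ⊗ₜ g.toLin v.1.2.1 + Polynomial.X ⊗ₜ h.toLin v.1.1)
        = Polynomial.X ⊗ₜ DGLA.polyEval M (1 : 𝕜) (polyPrimitive 𝕜 M
            (-(DGLA.polyDeriv 𝕜 M v.1.2.2.1 - Z.d.lTensor 𝕜[X] v.1.2.2.2)))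
          - polyPrimitive 𝕜 M (-(DGLA.polyDeriv 𝕜 M v.1.2.2.1 - Z.d.lTensor 𝕜[X] v.1.2.2.2))
          + -Z.d.lTensor 𝕜[X] (Polynomial.X ⊗ₜ DGLA.polyEval M (1 : 𝕜)
            (polyPrimitive 𝕜 M v.1.2.2.2) - polyPrimitive 𝕜 M v.1.2.2.2)
      rw [h1, h0]
      simp only [map_neg, map_sub, polyPrimitive_polyDeriv, polyPrimitive_lTensor,
        polyEval_lTensor, LinearMap.lTensor_tmul, TensorProduct.tmul_sub, TensorProduct.tmul_neg,
        TensorProduct.sub_tmul, DGLA.polyEval_tmul, Polynomial.eval_one, one_smul]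
      abel
    · change v.1.2.2.2 - 1 ⊗ₜ DGLA.polyEval M (1 : 𝕜) (polyPrimitive 𝕜 M v.1.2.2.2)
        = 0 + -(DGLA.polyDeriv 𝕜 M (Polynomial.X ⊗ₜ DGLA.polyEval M (1 : 𝕜)
            (polyPrimitive 𝕜 M v.1.2.2.2) - polyPrimitive 𝕜 M v.1.2.2.2)
            - Z.d.lTensor 𝕜[X] 0)
      rw [map_sub, polyDeriv_polyPrimitive]
      simp [DGLA.polyDeriv]
  π_q₂ v w := by
    obtain ⟨h1, h2, h3⟩ := pathDGLA_q₂_pathK h g v w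
    refine Prod.ext h1 (Prod.ext h2 ?_)
    exact (congrArg (fun x => DGLA.polyEval M (1 : 𝕜) (polyPrimitive 𝕜 M x)) h3).trans (by simp)
  K_q₂ v w := by
    obtain ⟨-, -, h3⟩ := pathDGLA_q₂_pathK h g v w
    refine Subtype.ext (Prod.ext rfl (Prod.ext rfl (Prod.ext ?_ rfl)))
    exact (congrArg (fun x => (Polynomial.X : 𝕜[X]) ⊗ₜ[𝕜] DGLA.polyEval M (1 : 𝕜)
      (polyPrimitive 𝕜 M x) - polyPrimitive 𝕜 M x) h3).trans (by simp)

end Cone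

instance multilinearMap_isScalarTower {𝕜 : Type*} [Field 𝕜] (A : Type*) [CommRing A] [Algebra 𝕜 A]
    {ι P Q : Type*} [AddCommGroup P] [Module A P] [AddCommGroup Q] [Module A Q] [Module 𝕜 Q]
    [IsScalarTower 𝕜 A Q] : IsScalarTower 𝕜 A (MultilinearMap A (fun _ : ι => P) Q) :=
  ⟨fun c a q => by ext γ; exact smul_assoc c a (q γ)⟩

/-- The extension of scalars along `𝕜 → A` of a multilinear map `q : Vⁿ → W`, characterized by
`(a₁ ⊗ v₁, …, aₙ ⊗ vₙ) ↦ a₁ ⋯ aₙ ⊗ q (v₁, …, vₙ)`. -/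
def extend {𝕜 : Type*} [Field 𝕜] {V W : Type*} [AddCommGroup V] [Module 𝕜 V]
    [AddCommGroup W] [Module 𝕜 W] (A : Type*) [CommRing A] [Algebra 𝕜 A] : (n : ℕ) →
    MultilinearMap 𝕜 (fun _ : Fin n => V) W →ₗ[𝕜]
      MultilinearMap A (fun _ : Fin n => A ⊗[𝕜] V) (A ⊗[𝕜] W)
  | 0 =>
    { toFun := fun q => MultilinearMap.constOfIsEmpty A _ (1 ⊗ₜ q 0)
      map_add' := fun q q' => by ext; simp [TensorProduct.tmul_add]
      map_smul' := fun c q => by ext; simp }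
  | n + 1 =>
    { toFun := fun q => ((extend A n ∘ₗ q.curryLeft).liftBaseChange A).uncurryLeft
      map_add' := fun q q' => by
        have : (q + q').curryLeft = q.curryLeft + q'.curryLeft := rfl
        rw [this, LinearMap.comp_add, LinearMap.liftBaseChange, map_add]
        rfl
      map_smul' := fun c q => by
        have : (c • q).curryLeft = c • q.curryLeft := rfl
        ext γ
        simp only [this, LinearMap.uncurryLeft_apply, LinearMap.comp_smul, RingHom.id_apply,
          smul_apply]
        induction γ 0 using TensorProduct.induction_on with
        | zero => simp
        | tmul a v => simp [smul_comm c a]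
        | add x y hx hy => simp only [map_add, add_apply, hx, hy, smul_add] }

theorem extend_succ {𝕜 : Type*} [Field 𝕜] {V W : Type*} [AddCommGroup V] [Module 𝕜 V]
    [AddCommGroup W] [Module 𝕜 W] (A : Type*) [CommRing A] [Algebra 𝕜 A] (n : ℕ)
    (q : MultilinearMap 𝕜 (fun _ : Fin (n + 1) => V) W) (γ : Fin (n + 1) → A ⊗[𝕜] V) :
    extend A (n + 1) q γ =
      (extend A n ∘ₗ q.curryLeft).liftBaseChange A (γ 0) (Fin.tail γ) := rfl

theorem extend_tmul {𝕜 : Type*} [Field 𝕜] {V W : Type*} [AddCommGroup V] [Module 𝕜 V]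
    [AddCommGroup W] [Module 𝕜 W] (A : Type*) [CommRing A] [Algebra 𝕜 A] (n : ℕ)
    (q : MultilinearMap 𝕜 (fun _ : Fin n => V) W) (a : Fin n → A) (v : Fin n → V) :
    extend A n q (fun i => a i ⊗ₜ v i) = (∏ i, a i) ⊗ₜ q v := by
  induction n with
  | zero => simp [extend, Subsingleton.elim v 0]
  | succ n ih =>
    rw [extend_succ, LinearMap.liftBaseChange_tmul, smul_apply,
      LinearMap.comp_apply]
    have := ih (q.curryLeft (v 0)) (Fin.tail a) (Fin.tail v)
    change a 0 • extend A n (q.curryLeft (v 0))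
      (fun i => Fin.tail a i ⊗ₜ[𝕜] Fin.tail v i) = _
    rw [this, TensorProduct.smul_tmul', Fin.prod_univ_succ, MultilinearMap.curryLeft_apply,
      Fin.cons_self_tail]
    rfl

open IsLocalRing in
/-- The subspace `Vⁱ ⊗ m_A` of `A ⊗ V`, where `m_A` is the maximal ideal of `A`. -/
def Grading.coeff {𝕜 : Type*} [Field 𝕜] {V : Type*} [AddCommGroup V] [Module 𝕜 V]
    (G : Grading 𝕜 V) (A : Type*) [CommRing A] [IsLocalRing A] [Algebra 𝕜 A] (i : ℤ) :
    Submodule 𝕜 (A ⊗[𝕜] V) :=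
  LinearMap.range
    (TensorProduct.map ((maximalIdeal A).restrictScalars 𝕜).subtype (G.deg i).subtype)

namespace DGLA

variable {𝕜 : Type*} [Field 𝕜] {V : Type*} [AddCommGroup V] [Module 𝕜 V]
variable (X : DGLA 𝕜 V) (A : Type*) [CommRing A] [Algebra 𝕜 A]

/-- The differential of `A ⊗ V`. -/
def dA : A ⊗[𝕜] V →ₗ[A] A ⊗[𝕜] V := X.d.baseChange A

/-- The bracket of `A ⊗ V`. -/
def bracketA : A ⊗[𝕜] V →ₗ[A] A ⊗[𝕜] V →ₗ[A] A ⊗[𝕜] V :=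
  LinearMap.BilinMap.baseChange A X.bracket

/-- The set `MC_V(A)` of Maurer-Cartan elements: those `x ∈ V¹ ⊗ m_A` with
`dx + ½ [x, x] = 0`. -/
def IsMC [IsLocalRing A] (x : A ⊗[𝕜] V) : Prop :=
  x ∈ X.coeff A 1 ∧ X.dA A x + (2 : 𝕜)⁻¹ • X.bracketA A x x = 0

/-- The gauge action `e^a * x = x + ∑_{n ≥ 0} [a, -]ⁿ / (n + 1)! ([a, x] - da)`, a finite sum for
`a ∈ V⁰ ⊗ m_A` when `m_A` is nilpotent. -/
def gauge (a x : A ⊗[𝕜] V) : A ⊗[𝕜] V :=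
  x + ∑ᶠ n : ℕ, (((n + 1).factorial : ℕ) : 𝕜)⁻¹ •
    ((X.bracketA A a) ^ n) (X.bracketA A a x - X.dA A a)

end DGLA

/-- The set `MC^∞_C(A)` for a graded vector space `C` and multilinear brackets `⟨ ⟩ₙ` on its
suspension: those `γ ∈ C¹ ⊗ m_A` with `∑_{j ≥ 1} ⟨γ^{⊙ j}⟩ⱼ / j! = 0`, a finite sum when `m_A` is
nilpotent. -/
def IsMCInfty {𝕜 : Type*} [Field 𝕜] {C : Type*} [AddCommGroup C] [Module 𝕜 C] (G : Grading 𝕜 C)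
    (q : (n : ℕ) → MultilinearMap 𝕜 (fun _ : Fin n => C) C)
    (A : Type*) [CommRing A] [IsLocalRing A] [Algebra 𝕜 A] (γ : A ⊗[𝕜] C) : Prop :=
  γ ∈ G.coeff A 1 ∧
    ∑ᶠ j : ℕ, (((j + 1).factorial : ℕ) : 𝕜)⁻¹ • extend A (j + 1) (q (j + 1)) (fun _ => γ) = 0

/-- A local Artinian `𝕜`-algebra with residue field `𝕜`. -/
structure ArtAlg (𝕜 : Type*) [Field 𝕜] where
  carrier : Type u
  [commRing : CommRing carrier]
  [algebra : Algebra 𝕜 carrier]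
  [isLocalRing : IsLocalRing carrier]
  [isArtinianRing : IsArtinianRing carrier]
  residue : Function.Bijective (algebraMap 𝕜 (IsLocalRing.ResidueField carrier))

namespace ArtAlg

variable {𝕜 : Type*} [Field 𝕜]

instance : CoeSort (ArtAlg.{u} 𝕜) (Type u) := ⟨ArtAlg.carrier⟩

attribute [instance] commRing algebra isLocalRing isArtinianRing

/-- The category of local Artinian `𝕜`-algebras with residue field `𝕜`. -/
instance : CategoryTheory.Category (ArtAlg.{u} 𝕜) where
  Hom A B := A →ₐ[𝕜] B
  id A := AlgHom.id 𝕜 A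
  comp f g := g.comp f

/-- A morphism `A → B` as a homomorphism of algebras. -/
def toAlgHom {A B : ArtAlg.{u} 𝕜} (f : A ⟶ B) : A →ₐ[𝕜] B := f

/-- The map `A ⊗ V → B ⊗ V` induced by a morphism `A → B`. -/
def mapCoeff {A B : ArtAlg.{u} 𝕜} (f : A ⟶ B) (V : Type*) [AddCommGroup V] [Module 𝕜 V] :
    A ⊗[𝕜] V →ₗ[𝕜] B ⊗[𝕜] V := (toAlgHom f).toLinearMap.rTensor V

end ArtAlg

section Functoriality

open ArtAlg IsLocalRing

variable {𝕜 : Type*} [Field 𝕜] {V W : Type*} [AddCommGroup V] [Module 𝕜 V]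
  [AddCommGroup W] [Module 𝕜 W] {A B : ArtAlg.{u} 𝕜} (f : A ⟶ B)

@[simp] theorem mapCoeff_tmul (a : A) (v : V) :
    mapCoeff f V (a ⊗ₜ v) = toAlgHom f a ⊗ₜ v := rfl

theorem mapCoeff_smul (a : A) (x : A ⊗[𝕜] V) :
    mapCoeff f V (a • x) = toAlgHom f a • mapCoeff f V x := by
  induction x using TensorProduct.induction_on with
  | zero => simp
  | tmul b v => simp [TensorProduct.smul_tmul']
  | add x y hx hy => simp only [smul_add, map_add, hx, hy]

theorem mapCoeff_id (V : Type*) [AddCommGroup V] [Module 𝕜 V] (x : A ⊗[𝕜] V) :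
    mapCoeff (CategoryTheory.CategoryStruct.id A) V x = x := by
  induction x using TensorProduct.induction_on with
  | zero => simp
  | tmul b v => rfl
  | add x y hx hy => simp only [map_add, hx, hy]

theorem mapCoeff_comp {C : ArtAlg.{u} 𝕜} (g : B ⟶ C) (V : Type*) [AddCommGroup V] [Module 𝕜 V]
    (x : A ⊗[𝕜] V) :
    mapCoeff (CategoryTheory.CategoryStruct.comp f g) V x = mapCoeff g V (mapCoeff f V x) := by
  induction x using TensorProduct.induction_on with
  | zero => simp
  | tmul b v => rfl
  | add x y hx hy => simp only [map_add, hx, hy]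

theorem exists_maximalIdeal_pow_eq_bot (A : ArtAlg.{u} 𝕜) :
    ∃ n : ℕ, maximalIdeal A ^ n = ⊥ := by
  obtain ⟨n, hn⟩ := IsArtinianRing.isNilpotent_jacobson_bot (R := A)
  exact ⟨n, by rwa [IsLocalRing.jacobson_eq_maximalIdeal _ bot_ne_top] at hn⟩

theorem map_mem_maximalIdeal {a : A} (ha : a ∈ maximalIdeal A) :
    toAlgHom f a ∈ maximalIdeal B := by
  obtain ⟨n, hn⟩ := exists_maximalIdeal_pow_eq_bot A
  have h : a ^ n = 0 := by
    have := Ideal.pow_mem_pow ha n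
    rwa [hn] at this
  rw [mem_maximalIdeal, mem_nonunits_iff]
  intro hu
  have := hu.pow n
  rw [← map_pow, h, map_zero] at this
  exact not_isUnit_zero this

theorem mapCoeff_mem (G : Grading 𝕜 V) (i : ℤ) {x : A ⊗[𝕜] V} (hx : x ∈ G.coeff A i) :
    mapCoeff f V x ∈ G.coeff B i := by
  obtain ⟨y, rfl⟩ := hx
  induction y using TensorProduct.induction_on with
  | zero => simp
  | tmul a v => exact ⟨⟨toAlgHom f a, map_mem_maximalIdeal f a.2⟩ ⊗ₜ v, rfl⟩
  | add y z hy hz => rw [map_add, map_add]; exact add_mem hy hz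

theorem coeff_le_smul_top (G : Grading 𝕜 V) (i : ℤ) {x : A ⊗[𝕜] V} (hx : x ∈ G.coeff A i) :
    x ∈ maximalIdeal A • (⊤ : Submodule A (A ⊗[𝕜] V)) := by
  obtain ⟨y, rfl⟩ := hx
  induction y using TensorProduct.induction_on with
  | zero => simp
  | tmul a v =>
    have : TensorProduct.map ((maximalIdeal A).restrictScalars 𝕜).subtype (G.deg i).subtype
        (a ⊗ₜ v) = (a : A) • ((1 : A) ⊗ₜ (v : V)) := by
      simp [TensorProduct.smul_tmul']
    rw [this]
    exact Submodule.smul_mem_smul a.2 trivial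
  | add y z hy hz => rw [map_add]; exact add_mem hy hz

theorem multilinear_mem_pow_smul_top {P Q : Type*} [AddCommGroup P] [Module A P]
    [AddCommGroup Q] [Module A Q] (I : Ideal A) (n : ℕ)
    (q : MultilinearMap A (fun _ : Fin n => P) Q) (γ : Fin n → P)
    (hγ : ∀ i, γ i ∈ I • (⊤ : Submodule A P)) : q γ ∈ I ^ n • (⊤ : Submodule A Q) := by
  induction n with
  | zero => simp
  | succ n ih =>
    have h : ∀ x ∈ I • (⊤ : Submodule A P),
        q.curryLeft x (Fin.tail γ) ∈ I ^ (n + 1) • (⊤ : Submodule A Q) := by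
      intro x hx
      refine Submodule.smul_induction_on hx (fun a ha x _ => ?_) (fun x y hx hy => ?_)
      · rw [map_smul, smul_apply, pow_succ', Submodule.mul_smul]
        exact Submodule.smul_mem_smul ha (ih _ _ fun i => hγ i.succ)
      · rw [map_add]; exact add_mem hx hy
    have := h (γ 0) (hγ 0)
    rwa [MultilinearMap.curryLeft_apply, Fin.cons_self_tail] at this

theorem bracketA_pow_mem (X : DGLA 𝕜 V) {a : A ⊗[𝕜] V}
    (ha : a ∈ maximalIdeal A • (⊤ : Submodule A (A ⊗[𝕜] V))) (x : A ⊗[𝕜] V) (n : ℕ) :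
    ((X.bracketA A a) ^ n) x ∈ maximalIdeal A ^ n • (⊤ : Submodule A (A ⊗[𝕜] V)) := by
  induction n with
  | zero => simp
  | succ n ih =>
    rw [pow_succ' (X.bracketA A a), Module.End.mul_apply, pow_succ' (maximalIdeal _),
      Submodule.mul_smul]
    generalize ((X.bracketA A a) ^ n) x = y at ih
    refine Submodule.smul_induction_on ha (fun b hb z _ => ?_) (fun z z' hz hz' => ?_)
    · rw [map_smul, LinearMap.smul_apply]
      refine Submodule.smul_mem_smul hb ?_
      refine Submodule.smul_induction_on ih (fun c hc w _ => ?_) (fun w w' hw hw' => ?_)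
      · rw [map_smul]; exact Submodule.smul_mem_smul hc trivial
      · rw [map_add]; exact add_mem hw hw'
    · rw [map_add, LinearMap.add_apply]; exact add_mem hz hz'

theorem hasFiniteSupport_of_mem_pow {P : Type*} [AddCommGroup P] [Module A P] (F : ℕ → P)
    (hF : ∀ n, F n ∈ maximalIdeal A ^ n • (⊤ : Submodule A P)) :
    Function.HasFiniteSupport F := by
  obtain ⟨N, hN⟩ := exists_maximalIdeal_pow_eq_bot A
  refine (Set.finite_lt_nat N).subset fun n hn => ?_
  by_contra h
  apply hn
  have h0 : maximalIdeal A ^ n = ⊥ := by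
    rw [eq_bot_iff, ← hN]; exact Ideal.pow_le_pow_right (not_lt.mp h)
  have := hF n
  rwa [h0, Submodule.bot_smul, Submodule.mem_bot] at this

theorem smul_mem_of_mem {P : Type*} [AddCommGroup P] [Module A P] [Module 𝕜 P]
    [IsScalarTower 𝕜 A P] (S : Submodule A P) (c : 𝕜) {x : P} (hx : x ∈ S) : c • x ∈ S := by
  rw [← algebraMap_smul A c x]; exact S.smul_mem _ hx

theorem mapCoeff_dA (X : DGLA 𝕜 V) (x : A ⊗[𝕜] V) :
    mapCoeff f V (X.dA A x) = X.dA B (mapCoeff f V x) := by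
  induction x using TensorProduct.induction_on with
  | zero => simp
  | tmul b v => rfl
  | add x y hx hy => simp only [map_add, hx, hy]

theorem mapCoeff_bracketA (X : DGLA 𝕜 V) (x y : A ⊗[𝕜] V) :
    mapCoeff f V (X.bracketA A x y) = X.bracketA B (mapCoeff f V x) (mapCoeff f V y) := by
  induction x using TensorProduct.induction_on with
  | zero => simp
  | tmul a v =>
    induction y using TensorProduct.induction_on with
    | zero => simp
    | tmul b w => simp [DGLA.bracketA]
    | add x y hx hy => simp only [map_add, hx, hy]
  | add x y hx hy => simp only [map_add, LinearMap.add_apply, hx, hy]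

theorem mapCoeff_baseChange (φ : V →ₗ[𝕜] W) (x : A ⊗[𝕜] V) :
    mapCoeff f W (φ.baseChange A x) = φ.baseChange B (mapCoeff f V x) := by
  induction x using TensorProduct.induction_on with
  | zero => simp
  | tmul b v => rfl
  | add x y hx hy => simp only [map_add, hx, hy]

theorem mapCoeff_extend (n : ℕ) (q : MultilinearMap 𝕜 (fun _ : Fin n => V) W)
    (γ : Fin n → A ⊗[𝕜] V) :
    mapCoeff f W (extend A n q γ) = extend B n q (fun i => mapCoeff f V (γ i)) := by
  induction n with
  | zero => simp [extend]
  | succ n ih =>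
    rw [extend_succ, extend_succ]
    change _ = (LinearMap.liftBaseChange B (extend B n ∘ₗ q.curryLeft)) (mapCoeff f V (γ 0))
      (fun i => mapCoeff f V (Fin.tail γ i))
    induction γ 0 using TensorProduct.induction_on with
    | zero => simp
    | tmul a v => simp [mapCoeff_smul, ih]
    | add x y hx hy => simp only [map_add, add_apply, hx, hy]

theorem DGLA.IsMC.map {X : DGLA 𝕜 V} {x : A ⊗[𝕜] V} (hx : X.IsMC A x) :
    X.IsMC B (mapCoeff f V x) := by
  refine ⟨mapCoeff_mem f _ _ hx.1, ?_⟩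
  rw [← mapCoeff_dA, ← mapCoeff_bracketA, ← map_smul, ← map_add, hx.2, map_zero]

theorem mapCoeff_gauge (X : DGLA 𝕜 V) {a : A ⊗[𝕜] V} (ha : a ∈ X.coeff A 0) (x : A ⊗[𝕜] V) :
    mapCoeff f V (X.gauge A a x) = X.gauge B (mapCoeff f V a) (mapCoeff f V x) := by
  have hpow : ∀ (n : ℕ) (y : A ⊗[𝕜] V), mapCoeff f V (((X.bracketA A a) ^ n) y) =
      ((X.bracketA B (mapCoeff f V a)) ^ n) (mapCoeff f V y) := by
    intro n y
    induction n with
    | zero => simp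
    | succ n ih =>
      rw [pow_succ', pow_succ', Module.End.mul_apply, Module.End.mul_apply, mapCoeff_bracketA, ih]
  rw [DGLA.gauge, DGLA.gauge, map_add]
  congr 1
  have := (mapCoeff f V).toAddMonoidHom.map_finsum (f := fun n : ℕ =>
    (((n + 1).factorial : ℕ) : 𝕜)⁻¹ • ((X.bracketA A a) ^ n) (X.bracketA A a x - X.dA A a))
    (hasFiniteSupport_of_mem_pow _ fun n => smul_mem_of_mem _ _
      (bracketA_pow_mem X (coeff_le_smul_top _ _ ha) _ n))
  refine this.trans (finsum_congr fun n => ?_)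
  simp [hpow, mapCoeff_bracketA, mapCoeff_dA]

theorem IsMCInfty.map {G : Grading 𝕜 V} {q : (n : ℕ) → MultilinearMap 𝕜 (fun _ : Fin n => V) V}
    {γ : A ⊗[𝕜] V} (hγ : IsMCInfty G q A γ) : IsMCInfty G q B (mapCoeff f V γ) := by
  refine ⟨mapCoeff_mem f _ _ hγ.1, ?_⟩
  have := (mapCoeff f V).toAddMonoidHom.map_finsum (f := fun j : ℕ =>
    (((j + 1).factorial : ℕ) : 𝕜)⁻¹ • extend A (j + 1) (q (j + 1)) (fun _ => γ))
    (hasFiniteSupport_of_mem_pow _ fun n => smul_mem_of_mem _ _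
      (Submodule.smul_mono_left (Ideal.pow_le_pow_right n.le_succ)
        (multilinear_mem_pow_smul_top _ (n + 1) (extend A (n + 1) (q (n + 1))) (fun _ => γ)
        fun _ => coeff_le_smul_top _ _ hγ.1)))
  rw [hγ.2, map_zero] at this
  rw [this]
  refine finsum_congr fun n => ?_
  simp [mapCoeff_extend]

end Functoriality

/-- The functor `MC^∞_C` of a graded vector space `C` with brackets on its suspension. -/
def mcInfty {𝕜 : Type*} [Field 𝕜] {C : Type v} [AddCommGroup C] [Module 𝕜 C] (G : Grading 𝕜 C)
    (q : (n : ℕ) → MultilinearMap 𝕜 (fun _ : Fin n => C) C) :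
    CategoryTheory.Functor (ArtAlg.{u} 𝕜) (Type (max u v)) where
  obj A := {γ : A ⊗[𝕜] C // IsMCInfty G q A γ}
  map f := TypeCat.ofHom fun γ => ⟨ArtAlg.mapCoeff f C γ.1, γ.2.map f⟩
  map_id A := by
    apply CategoryTheory.ConcreteCategory.hom_ext
    intro γ
    exact Subtype.ext (mapCoeff_id C γ.1)
  map_comp f g := by
    apply CategoryTheory.ConcreteCategory.hom_ext
    intro γ
    exact Subtype.ext (mapCoeff_comp f g C γ.1)

/-- The formal exponentials `e^p`, `p ∈ M⁰ ⊗ m_A`: the set underlying `exp(M⁰ ⊗ m_A)`. -/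
@[ext] structure Expo {𝕜 : Type*} [Field 𝕜] {M : Type v} [AddCommGroup M] [Module 𝕜 M]
    (Z : DGLA 𝕜 M) (A : Type u) [CommRing A] [IsLocalRing A] [Algebra 𝕜 A] : Type (max u v) where
  log : A ⊗[𝕜] M
  log_mem : log ∈ Z.coeff A 0

section PairFunctor

variable {𝕜 : Type*} [Field 𝕜] {L N M : Type v} [AddCommGroup L] [Module 𝕜 L]
  [AddCommGroup N] [Module 𝕜 N] [AddCommGroup M] [Module 𝕜 M]
  {X : DGLA 𝕜 L} {Y : DGLA 𝕜 N} {Z : DGLA 𝕜 M}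

/-- The conditions that define `MC_(h,g)(A)`: `x` and `y` are Maurer-Cartan elements and
`g(y) = e^p * h(x)`. -/
def IsMCPair (h : X.Hom Z) (g : Y.Hom Z) (A : Type u) [CommRing A] [IsLocalRing A] [Algebra 𝕜 A]
    (x : A ⊗[𝕜] L) (y : A ⊗[𝕜] N) (E : Expo Z A) : Prop :=
  X.IsMC A x ∧ Y.IsMC A y ∧
    g.toLin.baseChange A y = Z.gauge A E.log (h.toLin.baseChange A x)

/-- The functor `MC_(h,g)` of a pair of morphisms of differential graded Lie algebras. -/
def mcPair (h : X.Hom Z) (g : Y.Hom Z) :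
    CategoryTheory.Functor (ArtAlg.{u} 𝕜) (Type (max u v)) where
  obj A := {w : (A ⊗[𝕜] L) × (A ⊗[𝕜] N) × Expo Z A // IsMCPair h g A w.1 w.2.1 w.2.2}
  map f := TypeCat.ofHom fun w => ⟨(ArtAlg.mapCoeff f L w.1.1, ArtAlg.mapCoeff f N w.1.2.1,
      ⟨ArtAlg.mapCoeff f M w.1.2.2.log, mapCoeff_mem f _ _ w.1.2.2.log_mem⟩),
    w.2.1.map f, w.2.2.1.map f, by
      rw [← mapCoeff_baseChange, ← mapCoeff_baseChange, w.2.2.2,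
        mapCoeff_gauge f Z w.1.2.2.log_mem]⟩
  map_id A := by
    apply CategoryTheory.ConcreteCategory.hom_ext
    intro w
    exact Subtype.ext (Prod.ext (mapCoeff_id L _) (Prod.ext (mapCoeff_id N _)
      (Expo.ext (mapCoeff_id M _))))
  map_comp f g := by
    apply CategoryTheory.ConcreteCategory.hom_ext
    intro w
    exact Subtype.ext (Prod.ext (mapCoeff_comp f g L _) (Prod.ext (mapCoeff_comp f g N _)
      (Expo.ext (mapCoeff_comp f g M _))))

/-- The brackets `⟨ ⟩ₙ` on the suspension of the cone `C_(h,g)`, transferred from `H_(h,g)`. -/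
def coneBracket [CharZero 𝕜] (h : X.Hom Z) (g : Y.Hom Z) (n : ℕ) :
    MultilinearMap 𝕜 (fun _ : Fin n => L × N × M) (L × N × M) :=
  (pathContraction h g).bracket n

/-- The element `(l, n, m)` of `A ⊗ C_(h,g)`, for `l ∈ A ⊗ L`, `n ∈ A ⊗ N` and `m ∈ A ⊗ M`. -/
def coneElt (A : Type u) [CommRing A] [Algebra 𝕜 A] (l : A ⊗[𝕜] L) (n : A ⊗[𝕜] N)
    (m : A ⊗[𝕜] M) : A ⊗[𝕜] (L × N × M) :=
  (LinearMap.inl 𝕜 L (N × M)).baseChange A l +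
    (LinearMap.inr 𝕜 L (N × M) ∘ₗ LinearMap.inl 𝕜 N M).baseChange A n +
    (LinearMap.inr 𝕜 L (N × M) ∘ₗ LinearMap.inr 𝕜 N M).baseChange A m

end PairFunctor

end

/-!
The contraction of `H_(h,g)` onto the cone is explicit enough for all transferred brackets to be
computed. In a tree `π q₂(ι γ₀ ⊙ K q₂(ι γ₁ ⊙ ⋯))` the map `K` sees only the `dt`-component of its
argument, which is a sum of polynomials in `t` times nested commutators in `M`. The homotopy `K`
acts on the polynomials by `p ↦ t ∫₀¹ p - ∫₀ᵗ p`. This operator kills constants and sends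
`(B_k(t) - B_k) / k!` to `-(B_{k+1}(t) - B_{k+1}) / (k+1)!`
(`primitiveDefect_bernoulliKernel`). As `ι (l, n, m)` has the `𝕜[t]`-component
`g(n) + t (h(l) - g(n))`, whose slope `u = h(l) - g(n)` multiplies `t = B₁(t) - B₁`, the nested
expressions are Bernoulli polynomials times iterated brackets applied to `u` (`nested_succ`), and
the integral over `[0, 1]` in `π` leaves Bernoulli numbers (`tree_zero`, `tree_succ`).

The Koszul signs are harmless because an element of degree one is even in the suspension: when all
arguments but one are equal to an element `m` of degree one, the symmetrization runs over the
position of the remaining argument only (`Contraction.bracket_update`). If `m` lies in `M` and the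
remaining argument in `L` or `N`, only the two innermost positions contribute
(`sum_chain_update`), which gives the explicit brackets.

With coefficients in an Artinian algebra, the trees are extended multilinearly and evaluated on
`γ = (l, n, m)` with all arguments equal. With `a = [m, -]`, the component in `M` of the
Maurer-Cartan equation becomes `dm - [m, h(l)] = (a / (e^a - 1)) u` (`finsum_coneBracket`). The
operator `a` is nilpotent, so `a / (e^a - 1)` has the inverse `(e^a - 1) / a`
(`bernoulli_sum_eq_neg_iff`), and the equation is equivalent to
`g(n) = h(l) + ((e^a - 1) / a) ([m, h(l)] - dm) = e^m * h(l)` (`isMCInfty_coneElt_iff`). Since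
`A ⊗ (L × N × M)` splits into its three components naturally in `A`, this also yields the
isomorphism of functors (`mcPairIso`).
-/

/-! ### Bernoulli polynomials and the homotopy on polynomial forms -/

section Kernel

variable {𝕜 : Type*} [Field 𝕜]

/-- The operator `p ↦ t ∫₀¹ p(s) ds - ∫₀ᵗ p(s) ds` on polynomials, which gives the homotopy `K` on
the forms `dt p(t)`. -/
noncomputable def primitiveDefect (𝕜 : Type*) [Field 𝕜] : 𝕜[X] →ₗ[𝕜] 𝕜[X] :=
  (Polynomial.leval 1 ∘ₗ primitive 𝕜).smulRight Polynomial.X - primitive 𝕜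

theorem primitiveDefect_apply (p : 𝕜[X]) :
    primitiveDefect 𝕜 p = (primitive 𝕜 p).eval 1 • Polynomial.X - primitive 𝕜 p := rfl

theorem primitive_one : primitive 𝕜 1 = Polynomial.X := by
  rw [← Polynomial.C_1, ← Polynomial.monomial_zero_left, primitive_monomial]
  simp [Polynomial.monomial_one_one_eq_X]

/-- A constant form `dt v` is `ι` of an element of the cone, so `K` kills it. -/
theorem primitiveDefect_one : primitiveDefect 𝕜 1 = 0 := by
  simp [primitiveDefect_apply, primitive_one]

variable [CharZero 𝕜]

/-- The normalized Bernoulli polynomial `(B_{k+1}(t) - B_{k+1}) / (k+1)!`, which vanishes at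
`t = 0`. -/
noncomputable def bernoulliKernel (𝕜 : Type*) [Field 𝕜] [CharZero 𝕜] (k : ℕ) : 𝕜[X] :=
  (((k + 1).factorial : ℕ) : 𝕜)⁻¹ • ((Polynomial.bernoulli (k + 1)).map (algebraMap ℚ 𝕜) -
    Polynomial.C ((bernoulli (k + 1) : ℚ) : 𝕜))

theorem bernoulliKernel_zero : bernoulliKernel 𝕜 0 = Polynomial.X := by
  simp [bernoulliKernel, Polynomial.bernoulli_one, neg_div]

theorem eval_zero_map_bernoulli (k : ℕ) :
    ((Polynomial.bernoulli k).map (algebraMap ℚ 𝕜)).eval 0 = ((bernoulli k : ℚ) : 𝕜) := by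
  rw [← map_zero (algebraMap ℚ 𝕜), Polynomial.eval_map_apply, Polynomial.bernoulli_eval_zero]
  simp

theorem eval_one_map_bernoulli {k : ℕ} (hk : k ≠ 1) :
    ((Polynomial.bernoulli k).map (algebraMap ℚ 𝕜)).eval 1 = ((bernoulli k : ℚ) : 𝕜) := by
  rw [← map_one (algebraMap ℚ 𝕜), Polynomial.eval_map_apply, Polynomial.bernoulli_eval_one,
    bernoulli_eq_bernoulli'_of_ne_one hk]
  simp

theorem primitive_map_bernoulli (k : ℕ) :
    primitive 𝕜 ((Polynomial.bernoulli k).map (algebraMap ℚ 𝕜)) =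
      ((k : 𝕜) + 1)⁻¹ • ((Polynomial.bernoulli (k + 1)).map (algebraMap ℚ 𝕜) -
        Polynomial.C ((bernoulli (k + 1) : ℚ) : 𝕜)) := by
  have hk : (k : 𝕜) + 1 ≠ 0 := by exact_mod_cast k.succ_ne_zero
  have h : (Polynomial.bernoulli k).map (algebraMap ℚ 𝕜) = ((k : 𝕜) + 1)⁻¹ •
      Polynomial.derivative ((Polynomial.bernoulli (k + 1)).map (algebraMap ℚ 𝕜)) := by
    rw [Polynomial.derivative_map, Polynomial.derivative_bernoulli_add_one, eq_inv_smul_iff₀ hk,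
      Polynomial.smul_eq_C_mul]
    simp
  rw [h, map_smul, primitive_derivative, eval_zero_map_bernoulli]

theorem primitive_bernoulliKernel (k : ℕ) :
    primitive 𝕜 (bernoulliKernel 𝕜 k) = bernoulliKernel 𝕜 (k + 1) -
      ((((k + 1).factorial : ℕ) : 𝕜)⁻¹ * ((bernoulli (k + 1) : ℚ) : 𝕜)) • Polynomial.X := by
  have hC : primitive 𝕜 (Polynomial.C ((bernoulli (k + 1) : ℚ) : 𝕜)) =
      ((bernoulli (k + 1) : ℚ) : 𝕜) • Polynomial.X := by
    rw [← primitive_one, ← map_smul, Polynomial.smul_eq_C_mul, mul_one]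
  rw [bernoulliKernel, map_smul, map_sub, primitive_map_bernoulli, hC, bernoulliKernel, smul_sub,
    smul_smul, smul_smul]
  congr 2
  rw [Nat.factorial_succ (k + 1), ← mul_inv]
  push_cast
  ring

theorem eval_one_bernoulliKernel_succ (k : ℕ) : (bernoulliKernel 𝕜 (k + 1)).eval 1 = 0 := by
  simp [bernoulliKernel, eval_one_map_bernoulli (𝕜 := 𝕜) (k := k + 1 + 1) (by omega)]

/-- The integral of a Bernoulli polynomial of positive degree over `[0, 1]` vanishes, so only the
constant term contributes. -/
theorem integral_bernoulliKernel (k : ℕ) : (primitive 𝕜 (bernoulliKernel 𝕜 k)).eval 1 =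
    -((((k + 1).factorial : ℕ) : 𝕜)⁻¹ * ((bernoulli (k + 1) : ℚ) : 𝕜)) := by
  rw [primitive_bernoulliKernel]
  simp [eval_one_bernoulliKernel_succ]

theorem primitiveDefect_bernoulliKernel (k : ℕ) :
    primitiveDefect 𝕜 (bernoulliKernel 𝕜 k) = -bernoulliKernel 𝕜 (k + 1) := by
  rw [primitiveDefect_apply, integral_bernoulliKernel, primitive_bernoulliKernel]
  module

end Kernel

/-! ### The transferred trees -/

section Trees

variable {𝕜 : Type*} [Field 𝕜] {L N M : Type*} [AddCommGroup L] [Module 𝕜 L]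
  [AddCommGroup N] [Module 𝕜 N] [AddCommGroup M] [Module 𝕜 M]
  {X : DGLA 𝕜 L} {Y : DGLA 𝕜 N} {Z : DGLA 𝕜 M}

theorem Grading.shift_sgn (G : Grading 𝕜 M) (m : M) : G.shift.sgn m = -G.sgn m := by
  induction m using G.shift.induction_on with
  | hmem i v hv =>
    rw [G.shift.sgn_of_mem hv, G.sgn_of_mem (i := i - 1) hv, DGLA.neg_one_zpow_sub_one, neg_smul,
      neg_neg]
  | h0 => simp
  | hadd v w hv hw => rw [map_add, map_add, hv, hw, neg_add]

theorem Grading.sgn_sgn (G : Grading 𝕜 M) (m : M) : G.sgn (G.sgn m) = m := by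
  induction m using G.induction_on with
  | hmem i v hv =>
    rw [G.sgn_of_mem hv, map_smul, G.sgn_of_mem hv, smul_smul, DGLA.neg_one_zpow_mul_self, one_smul]
  | h0 => simp
  | hadd v w hv hw => rw [map_add, map_add, hv, hw]

theorem Grading.lTensor_sgn_tmul {U : Type*} [AddCommGroup U] [Module 𝕜 U] (G : Grading 𝕜 M)
    (p : U) (m : M) : (G.lTensor U).sgn (p ⊗ₜ m) = p ⊗ₜ G.sgn m := by
  induction m using G.induction_on with
  | hmem i v hv =>
    rw [G.sgn_of_mem hv, Grading.sgn_of_mem _ (DGLA.tmul_mem_lTensor_deg G p hv),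
      TensorProduct.tmul_smul]
  | h0 => simp
  | hadd v w hv hw => rw [map_add, TensorProduct.tmul_add, TensorProduct.tmul_add, map_add, hv, hw]

/-- The projection of `L × N × M` onto its first summand. -/
abbrev coneFst (𝕜 L N M : Type*) [Field 𝕜] [AddCommGroup L] [Module 𝕜 L] [AddCommGroup N]
    [Module 𝕜 N] [AddCommGroup M] [Module 𝕜 M] : (L × N × M) →ₗ[𝕜] L := LinearMap.fst 𝕜 L (N × M)

/-- The projection of `L × N × M` onto its second summand. -/
abbrev coneSnd (𝕜 L N M : Type*) [Field 𝕜] [AddCommGroup L] [Module 𝕜 L] [AddCommGroup N]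
    [Module 𝕜 N] [AddCommGroup M] [Module 𝕜 M] : (L × N × M) →ₗ[𝕜] N :=
  LinearMap.fst 𝕜 N M ∘ₗ LinearMap.snd 𝕜 L (N × M)

/-- The projection of `L × N × M` onto its third summand. -/
abbrev coneThd (𝕜 L N M : Type*) [Field 𝕜] [AddCommGroup L] [Module 𝕜 L] [AddCommGroup N]
    [Module 𝕜 N] [AddCommGroup M] [Module 𝕜 M] : (L × N × M) →ₗ[𝕜] M :=
  LinearMap.snd 𝕜 N M ∘ₗ LinearMap.snd 𝕜 L (N × M)

/-- The inclusion of `M` as the third summand of `L × N × M`. -/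
abbrev inThd (𝕜 L N M : Type*) [Field 𝕜] [AddCommGroup L] [Module 𝕜 L] [AddCommGroup N]
    [Module 𝕜 N] [AddCommGroup M] [Module 𝕜 M] : M →ₗ[𝕜] (L × N × M) :=
  LinearMap.inr 𝕜 L (N × M) ∘ₗ LinearMap.inr 𝕜 N M

/-- The map `(l, n, m) ↦ h(l) - g(n)`: the derivative of the path `(1 - t) g(n) + t h(l)`. -/
def coneSlope (h : X.Hom Z) (g : Y.Hom Z) : (L × N × M) →ₗ[𝕜] M :=
  h.toLin ∘ₗ coneFst 𝕜 L N M - g.toLin ∘ₗ coneSnd 𝕜 L N M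

/-- The operator `(l, n, m) ↦ -[(-1)^(deg m) m, -]`: the adjoint action, with the sign of `q₂`, of
the component `dt m` of `ι (l, n, m)`. -/
noncomputable def coneAd (L N : Type*) [AddCommGroup L] [Module 𝕜 L] [AddCommGroup N]
    [Module 𝕜 N] (Z : DGLA 𝕜 M) : (L × N × M) →ₗ[𝕜] M →ₗ[𝕜] M :=
  (-Z.bracket) ∘ₗ Z.sgn ∘ₗ coneThd 𝕜 L N M

/-- The bilinear map `(c, c') ↦ -[(-1)^(deg m) m, φ(c')] + [φ(c), m']`, where `m` and `m'` are the
components of `c` and `c'` in `M`: the two mixed terms of the bracket of `φ(c) + dt m` and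
`φ(c') + dt m'`, with the sign of `q₂`. -/
noncomputable def mixedBracket (Z : DGLA 𝕜 M) (φ : (L × N × M) →ₗ[𝕜] M) :
    (L × N × M) →ₗ[𝕜] (L × N × M) →ₗ[𝕜] M :=
  Z.bracket.compl₁₂ φ (coneThd 𝕜 L N M) - Z.bracket.compl₁₂ (Z.sgn ∘ₗ coneThd 𝕜 L N M) φ

/-- The nested commutators `[m₀, [m₁, ⋯ [mₙ, h(lₙ₊₁) - g(nₙ₊₁)]]]` (up to sign and
symmetrization of the innermost bracket) that remain of a tree once the polynomials in `t` have
been split off. -/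
noncomputable def chain (h : X.Hom Z) (g : Y.Hom Z) :
    (n : ℕ) → MultilinearMap 𝕜 (fun _ : Fin (n + 2) => L × N × M) M
  | 0 => consMap (mixedBracket Z (coneSlope h g))
      (MultilinearMap.ofSubsingleton 𝕜 _ _ (0 : Fin 1) LinearMap.id)
  | n + 1 => consMap (coneAd L N Z) (chain h g n)

/-- The binary tree `π q₂(ι c ⊙ ι c')`, in terms of the brackets of `L`, `N` and `M`. -/
noncomputable def binaryTree (h : X.Hom Z) (g : Y.Hom Z) :
    (L × N × M) →ₗ[𝕜] (L × N × M) →ₗ[𝕜] (L × N × M) :=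
  (X.q₂.compl₁₂ (coneFst 𝕜 L N M) (coneFst 𝕜 L N M)).compr₂ (LinearMap.inl 𝕜 L (N × M)) +
  (Y.q₂.compl₁₂ (coneSnd 𝕜 L N M) (coneSnd 𝕜 L N M)).compr₂
    (LinearMap.inr 𝕜 L (N × M) ∘ₗ LinearMap.inl 𝕜 N M) +
  (mixedBracket Z (g.toLin ∘ₗ coneSnd 𝕜 L N M) +
    (2 : 𝕜)⁻¹ • mixedBracket Z (coneSlope h g)).compr₂ (inThd 𝕜 L N M)

theorem pathDGLA_sgn (h : X.Hom Z) (g : Y.Hom Z) (y : pathSubmodule h g) :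
    ((pathDGLA h g).sgn y).1 =
      (X.sgn y.1.1, Y.sgn y.1.2.1, ((Z.lTensor 𝕜[X]).sgn y.1.2.2.1,
        -(Z.lTensor 𝕜[X]).sgn y.1.2.2.2)) := by
  have e1 := Grading.map_scale (pathDGLA h g).toGrading X.toGrading
    (LinearMap.fst 𝕜 _ _ ∘ₗ (pathSubmodule h g).subtype) (fun i v hv => hv.1)
    (fun i => (-1) ^ i) y
  have e2 := Grading.map_scale (pathDGLA h g).toGrading Y.toGrading
    (LinearMap.fst 𝕜 _ _ ∘ₗ LinearMap.snd 𝕜 _ _ ∘ₗ (pathSubmodule h g).subtype)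
    (fun i v hv => hv.2.1) (fun i => (-1) ^ i) y
  have e3 := Grading.map_scale (pathDGLA h g).toGrading (Z.lTensor 𝕜[X])
    (LinearMap.fst 𝕜 _ _ ∘ₗ LinearMap.snd 𝕜 _ _ ∘ₗ LinearMap.snd 𝕜 _ _ ∘ₗ
      (pathSubmodule h g).subtype) (fun i v hv => hv.2.2.1) (fun i => (-1) ^ i) y
  have e4 := Grading.map_scale (pathDGLA h g).toGrading (Z.lTensor 𝕜[X]).shift
    (LinearMap.snd 𝕜 _ _ ∘ₗ LinearMap.snd 𝕜 _ _ ∘ₗ LinearMap.snd 𝕜 _ _ ∘ₗ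
      (pathSubmodule h g).subtype) (fun i v hv => hv.2.2.2) (fun i => (-1) ^ i) y
  exact Prod.ext e1 (Prod.ext e2 (Prod.ext e3 (e4.trans (Grading.shift_sgn _ _))))

/-- The component of `ι c` in `𝕜[t] ⊗ M`. -/
theorem pathι_poly (h : X.Hom Z) (g : Y.Hom Z) (c : L × N × M) :
    (pathι h g c).1.2.2.1 = 1 ⊗ₜ g.toLin c.2.1 + Polynomial.X ⊗ₜ coneSlope h g c := by
  change (1 - Polynomial.X) ⊗ₜ g.toLin c.2.1 + Polynomial.X ⊗ₜ h.toLin c.1 = _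
  simp only [coneSlope, LinearMap.sub_apply, LinearMap.comp_apply, LinearMap.fst_apply,
    LinearMap.snd_apply, TensorProduct.tmul_sub, TensorProduct.sub_tmul]
  abel

theorem pathDGLA_q₂_pathι (h : X.Hom Z) (g : Y.Hom Z) (c : L × N × M) (y : pathSubmodule h g) :
    ((pathDGLA h g).q₂ (pathι h g c) y).1.1 = X.q₂ c.1 y.1.1 ∧
    ((pathDGLA h g).q₂ (pathι h g c) y).1.2.1 = Y.q₂ c.2.1 y.1.2.1 ∧
    ((pathDGLA h g).q₂ (pathι h g c) y).1.2.2.2 =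
      -Z.polyBracket (1 ⊗ₜ Z.sgn c.2.2) y.1.2.2.1 +
        Z.polyBracket (pathι h g c).1.2.2.1 y.1.2.2.2 := by
  have hs := pathDGLA_sgn h g (pathι h g c)
  refine ⟨?_, ?_, ?_⟩
  · change X.bracket ((pathDGLA h g).sgn (pathι h g c)).1.1 _ = _
    rw [hs]; rfl
  · change Y.bracket ((pathDGLA h g).sgn (pathι h g c)).1.2.1 _ = _
    rw [hs]; rfl
  · change Z.polyBracket ((pathDGLA h g).sgn (pathι h g c)).1.2.2.2 _ +
      Z.polyBracket ((Z.lTensor 𝕜[X]).sgn ((pathDGLA h g).sgn (pathι h g c)).1.2.2.1) _ = _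
    rw [hs, Grading.sgn_sgn]
    congr 1
    change Z.polyBracket (-(Z.lTensor 𝕜[X]).sgn (1 ⊗ₜ c.2.2)) _ = _
    rw [Grading.lTensor_sgn_tmul, map_neg, LinearMap.neg_apply]

/-- The `dt`-component of `q₂(ι c ⊙ ι c')`. -/
theorem pathDGLA_q₂_pathι_pathι (h : X.Hom Z) (g : Y.Hom Z) (c c' : L × N × M) :
    ((pathDGLA h g).q₂ (pathι h g c) (pathι h g c')).1.2.2.2 =
      1 ⊗ₜ mixedBracket Z (g.toLin ∘ₗ coneSnd 𝕜 L N M) c c' +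
        Polynomial.X ⊗ₜ mixedBracket Z (coneSlope h g) c c' := by
  rw [(pathDGLA_q₂_pathι h g c _).2.2, pathι_poly, pathι_poly]
  change _ + Z.polyBracket _ (1 ⊗ₜ c'.2.2) = _
  simp only [map_add, LinearMap.add_apply, DGLA.polyBracket_tmul, mixedBracket,
    LinearMap.sub_apply, LinearMap.compl₁₂_apply, LinearMap.comp_apply, LinearMap.fst_apply,
    LinearMap.snd_apply, TensorProduct.tmul_sub, one_mul, mul_one]
  abel

theorem pathK_of_dt_eq (h : X.Hom Z) (g : Y.Hom Z) (y : pathSubmodule h g) (r : 𝕜[X] ⊗[𝕜] M)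
    (hy : y.1.2.2.2 = r) :
    (pathK h g y).1 = (0, 0, (primitiveDefect 𝕜).rTensor M r, 0) := by
  subst hy
  refine Prod.ext rfl (Prod.ext rfl (Prod.ext ?_ rfl))
  change Polynomial.X ⊗ₜ DGLA.polyEval M (1 : 𝕜) (polyPrimitive 𝕜 M y.1.2.2.2) -
    polyPrimitive 𝕜 M y.1.2.2.2 = (primitiveDefect 𝕜).rTensor M y.1.2.2.2
  induction y.1.2.2.2 using TensorProduct.induction_on with
  | zero => simp
  | tmul p v =>
    simp [polyPrimitive, primitiveDefect_apply, TensorProduct.sub_tmul,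
      TensorProduct.smul_tmul]
  | add x y hx hy =>
    rw [map_add, map_add, map_add, TensorProduct.tmul_add, ← hx, ← hy]
    abel

variable [CharZero 𝕜]

/-- A nested expression with at least two leaves is a function of `t` alone, and its dependence on
`t` is through a Bernoulli polynomial: each application of `K` raises the index of that polynomial
by one. -/
theorem nested_succ (h : X.Hom Z) (g : Y.Hom Z) (n : ℕ) (c : Fin (n + 2) → L × N × M) :
    ((pathContraction h g).nested (n + 1) c).1 =
      (0, 0, ((-1 : 𝕜) ^ (n + 1) • bernoulliKernel 𝕜 (n + 1)) ⊗ₜ chain h g n c, 0) := by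
  induction n with
  | zero =>
    refine (pathK_of_dt_eq h g _ _ (pathDGLA_q₂_pathι_pathι h g (c 0) (c 1))).trans ?_
    rw [map_add, LinearMap.rTensor_tmul, LinearMap.rTensor_tmul, primitiveDefect_one,
      ← bernoulliKernel_zero, primitiveDefect_bernoulliKernel]
    simp [chain, Fin.tail]
  | succ n ih =>
    have ih' := ih (Fin.tail c)
    refine (pathK_of_dt_eq h g _ _ (pathDGLA_q₂_pathι h g (c 0) _).2.2).trans ?_
    rw [ih', map_zero, add_zero, DGLA.polyBracket_tmul, ← TensorProduct.tmul_neg, one_mul,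
      LinearMap.rTensor_tmul, map_smul, primitiveDefect_bernoulliKernel, smul_neg, ← neg_smul,
      pow_succ _ (n + 1), mul_neg_one]
    rfl

theorem tree_zero (h : X.Hom Z) (g : Y.Hom Z) :
    (pathContraction h g).tree 0 = consMap (binaryTree h g)
      (MultilinearMap.ofSubsingleton 𝕜 _ _ (0 : Fin 1) LinearMap.id) := by
  ext1 c
  have key := pathDGLA_q₂_pathι h g (c 0) (pathι h g (c 1))
  refine (?_ : pathπ h g ((pathDGLA h g).q₂ (pathι h g (c 0)) (pathι h g (c 1))) =
    binaryTree h g (c 0) (c 1))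
  have hc : binaryTree h g (c 0) (c 1) = (X.q₂ (c 0).1 (c 1).1, Y.q₂ (c 0).2.1 (c 1).2.1,
      mixedBracket Z (g.toLin ∘ₗ coneSnd 𝕜 L N M) (c 0) (c 1) +
        (2 : 𝕜)⁻¹ • mixedBracket Z (coneSlope h g) (c 0) (c 1)) := by
    simp [binaryTree]
  rw [hc]
  refine Prod.ext key.1 (Prod.ext key.2.1 ?_)
  refine (congrArg (fun x => DGLA.polyEval M (1 : 𝕜) (polyPrimitive 𝕜 M x))
    (pathDGLA_q₂_pathι_pathι h g (c 0) (c 1))).trans ?_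
  -- the constant part of the form integrates to itself, the linear part `t v` to `v / 2`
  have hX := integral_bernoulliKernel (𝕜 := 𝕜) 0
  rw [bernoulliKernel_zero] at hX
  simp only [polyPrimitive, map_add, LinearMap.rTensor_tmul, DGLA.polyEval_tmul, hX,
    primitive_one]
  simp [bernoulli_one, neg_div]

theorem tree_succ (h : X.Hom Z) (g : Y.Hom Z) (n : ℕ) :
    (pathContraction h g).tree (n + 1) =
      ((((n + 2).factorial : ℕ) : 𝕜)⁻¹ * ((bernoulli (n + 2) : ℚ) : 𝕜)) •
        (inThd 𝕜 L N M).compMultilinearMap (chain h g (n + 1)) := by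
  ext1 c
  have key := pathDGLA_q₂_pathι h g (c 0) ((pathContraction h g).nested (n + 1) (Fin.tail c))
  rw [nested_succ] at key
  refine (?_ : pathπ h g ((pathDGLA h g).q₂ (pathι h g (c 0))
    ((pathContraction h g).nested (n + 1) (Fin.tail c))) = _)
  refine Prod.ext (key.1.trans ?_) (Prod.ext (key.2.1.trans ?_) ?_)
  · simp
  · simp
  · refine (congrArg (fun x => DGLA.polyEval M (1 : 𝕜) (polyPrimitive 𝕜 M x)) key.2.2).trans ?_
    rw [map_zero, add_zero, DGLA.polyBracket_tmul, one_mul, ← TensorProduct.tmul_neg]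
    -- the sign accumulated by the homotopies is invisible, as `B_k = 0` for odd `k ≥ 3`
    have hB : (-1 : 𝕜) ^ (n + 2) * ((bernoulli (n + 2) : ℚ) : 𝕜) =
        ((bernoulli (n + 2) : ℚ) : 𝕜) := by
      rcases Nat.even_or_odd (n + 2) with he | ho
      · rw [he.neg_one_pow, one_mul]
      · rw [bernoulli_eq_zero_of_odd ho (by omega)]; simp
    simp only [polyPrimitive, LinearMap.rTensor_tmul, DGLA.polyEval_tmul, map_smul,
      Polynomial.eval_smul, integral_bernoulliKernel]
    change _ = (_ : 𝕜) • coneAd L N Z (c 0) (chain h g n (Fin.tail c))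
    rw [smul_eq_mul]
    congr 1
    linear_combination (((n + 2).factorial : ℕ) : 𝕜)⁻¹ * hB

end Trees

/-! ### Brackets of even elements of the suspension -/

section Symmetrization

variable {𝕜 : Type*} [Field 𝕜]

theorem Grading.parityProj_of_mem {V : Type*} [AddCommGroup V] [Module 𝕜 V] (G : Grading 𝕜 V)
    {v : V} (hv : v ∈ G.deg 1) (e : ZMod 2) :
    G.parityProj (e + 1) v = if e = 0 then v else 0 := by
  rw [Grading.parityProj, G.scale_of_mem _ hv]
  by_cases he : e = 0
  · simp [he]
  · simp [he]

theorem Grading.sum_parityProj {V : Type*} [AddCommGroup V] [Module 𝕜 V] (G : Grading 𝕜 V)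
    (v : V) : ∑ e : ZMod 2, G.parityProj (e + 1) v = v := by
  induction v using G.induction_on with
  | hmem i v hv =>
    simp only [Grading.parityProj, G.scale_of_mem _ hv]
    rw [← Finset.sum_smul]
    have : ∑ e : ZMod 2, (if (i : ZMod 2) = e + 1 then (1 : 𝕜) else 0) = 1 := by
      rw [Finset.sum_eq_single ((i : ZMod 2) - 1)]
      · simp
      · intro b _ hb
        rw [if_neg]
        rintro h
        exact hb (by rw [h]; ring)
      · simp
    rw [this, one_smul]
  | h0 => simp
  | hadd v w hv hw => simp only [map_add, Finset.sum_add_distrib, hv, hw]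

/-- The Koszul sign is trivial when at most one of the vectors is odd. -/
theorem koszulSign_single {n : ℕ} (σ : Equiv.Perm (Fin n)) (q : Fin n) (a : ZMod 2) :
    koszulSign 𝕜 σ (Pi.single q a) = 1 := by
  refine Finset.prod_eq_one fun i _ => Finset.prod_eq_one fun j _ => ?_
  split_ifs with hij
  · by_cases hi : σ i = q
    · have hj : σ j ≠ q := fun hj => hij.2.ne (hj.trans hi.symm)
      simp [Pi.single_eq_of_ne hj]
    · simp [Pi.single_eq_of_ne hi]
  · rfl

/-- The positions of `q` under all permutations are equidistributed. -/
theorem sum_perm_symm_apply {W : Type*} [AddCommMonoid W] {n : ℕ} (f : Fin (n + 1) → W)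
    (q : Fin (n + 1)) :
    ∑ σ : Equiv.Perm (Fin (n + 1)), f (σ.symm q) = n.factorial • ∑ p, f p := by
  have h1 : ∑ σ : Equiv.Perm (Fin (n + 1)), f (σ.symm q) =
      ∑ σ : Equiv.Perm (Fin (n + 1)), f (σ 0) := by
    refine Fintype.sum_equiv ((Equiv.inv _).trans (Equiv.mulRight (Equiv.swap 0 q))) _ _
      fun σ => ?_
    simp [Equiv.Perm.inv_def]
  rw [h1, ← Equiv.sum_comp Equiv.Perm.decomposeFin.symm, Fintype.sum_prod_type]
  simp [Fintype.card_perm, Finset.smul_sum]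

theorem sum_pi_single {W : Type*} [AddCommMonoid W] {n : ℕ} (q : Fin n)
    (F : (Fin n → ZMod 2) → W) (hF : ∀ e, e ≠ Pi.single q (e q) → F e = 0) :
    ∑ e, F e = ∑ a, F (Pi.single q a) := by
  symm
  refine Finset.sum_of_injOn (fun a => (Pi.single q a : Fin n → ZMod 2)) (fun a _ b _ hab => Pi.single_injective q hab)
    (fun _ _ => Finset.mem_coe.2 (Finset.mem_univ _)) (fun e _ he => hF e fun h => he ?_)
    (fun _ _ => rfl)
  exact ⟨e q, Finset.mem_coe.2 (Finset.mem_univ _), h.symm⟩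

namespace Contraction

variable {V C : Type*} [AddCommGroup V] [Module 𝕜 V]
    [AddCommGroup C] [Module 𝕜 C] {X : DGLA 𝕜 V} {G : Grading 𝕜 C} {D : C →ₗ[𝕜] C}

/-- The inner sum over the parities in the definition of the bracket, when all entries but one are
equal to the same element of degree one (hence even in the suspension). -/
theorem sum_parity_update (G : Grading 𝕜 C) {n : ℕ} (t : MultilinearMap 𝕜 (fun _ : Fin n => C) C)
    {m : C} (hm : m ∈ G.deg 1) (x : C) (q : Fin n) (σ : Equiv.Perm (Fin n)) :
    ∑ e : Fin n → ZMod 2, koszulSign 𝕜 σ e •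
        (t.domDomCongr σ).compLinearMap (fun i => G.parityProj (e i + 1))
          (Function.update (fun _ => m) q x) =
      t (Function.update (fun _ => m) (σ.symm q) x) := by
  -- only those parities survive for which all entries but the one at `q` are even
  have hzero : ∀ e : Fin n → ZMod 2, e ≠ Pi.single q (e q) →
      koszulSign 𝕜 σ e • (t.domDomCongr σ).compLinearMap (fun i => G.parityProj (e i + 1))
        (Function.update (fun _ => m) q x) = 0 := by
    intro e he
    obtain ⟨i, hi⟩ := Function.ne_iff.mp he
    have hiq : i ≠ q := by rintro rfl; simp at hi
    rw [Pi.single_eq_of_ne hiq] at hi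
    rw [MultilinearMap.compLinearMap_apply, MultilinearMap.map_coord_zero _ i, smul_zero]
    rw [Function.update_of_ne hiq, G.parityProj_of_mem hm, if_neg hi]
  have hone : ∀ a : ZMod 2, koszulSign 𝕜 σ (Pi.single q a) •
      (t.domDomCongr σ).compLinearMap
        (fun i => G.parityProj ((Pi.single q a : Fin n → ZMod 2) i + 1))
        (Function.update (fun _ => m) q x) =
      t.domDomCongr σ (Function.update (fun _ => m) q (G.parityProj (a + 1) x)) := by
    intro a
    rw [koszulSign_single, one_smul, MultilinearMap.compLinearMap_apply]
    congr 1
    ext1 i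
    by_cases hi : i = q
    · subst hi
      rw [Function.update_self, Function.update_self, Pi.single_eq_same]
    · rw [Function.update_of_ne hi, Function.update_of_ne hi, Pi.single_eq_of_ne hi,
        G.parityProj_of_mem hm, if_pos rfl]
  rw [sum_pi_single q _ hzero, Finset.sum_congr rfl fun a _ => hone a, ← MultilinearMap.map_update_sum (t.domDomCongr σ) Finset.univ q
    (fun a => G.parityProj (a + 1) x), G.sum_parityProj, MultilinearMap.domDomCongr_apply]
  congr 1
  ext1 i
  simp [Function.update_apply, Equiv.eq_symm_apply]

/-- For an element `m` of degree one and an arbitrary element `x`, the symmetrization in the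
bracket is over the position of `x` only, without signs. -/
theorem bracket_update (T : Contraction X G D) (n : ℕ) {m : C} (hm : m ∈ G.deg 1) (x : C)
    (q : Fin (n + 2)) :
    T.bracket (n + 2) (Function.update (fun _ => m) q x) =
      ((-1 : 𝕜) ^ n / 2 * ((n + 1).factorial : ℕ)) •
        ∑ p, T.tree n (Function.update (fun _ => m) p x) := by
  change ((((-1 : 𝕜) ^ n / 2) • ∑ σ : Equiv.Perm (Fin (n + 2)), ∑ e : Fin (n + 2) → ZMod 2,
      koszulSign 𝕜 σ e • ((T.tree n).domDomCongr σ).compLinearMap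
        fun i => G.parityProj (e i + 1)) : MultilinearMap 𝕜 (fun _ : Fin (n + 2) => C) C) _ = _
  simp only [smul_apply, sum_apply]
  rw [Finset.sum_congr rfl fun σ _ => sum_parity_update G (T.tree n) hm x q σ,
    sum_perm_symm_apply fun p => T.tree n (Function.update (fun _ => m) p x),
    ← Nat.cast_smul_eq_nsmul 𝕜, smul_smul]

end Contraction

end Symmetrization

/-! ### The brackets of one element of `L` or `N` with copies of one element of `M` -/

section ExplicitBrackets

variable {𝕜 : Type*} [Field 𝕜] {L N M : Type v} [AddCommGroup L] [Module 𝕜 L]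
  [AddCommGroup N] [Module 𝕜 N] [AddCommGroup M] [Module 𝕜 M]
  {X : DGLA 𝕜 L} {Y : DGLA 𝕜 N} {Z : DGLA 𝕜 M}

theorem DGLA.bracket_zero_comm (Z : DGLA 𝕜 M) {m : M} (hm : m ∈ Z.deg 0) (v : M) :
    Z.bracket v m = -Z.bracket m v := by
  induction v using Z.induction_on with
  | hmem i v hv => rw [Z.skew i 0 v hv m hm]; simp
  | h0 => simp
  | hadd v w hv hw => rw [map_add, map_add, LinearMap.add_apply, hv, hw, neg_add]

theorem inThd_mem {m : M} (hm : m ∈ Z.deg 0) :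
    ((0, 0, m) : L × N × M) ∈ (coneGrading X Y Z).deg 1 :=
  ⟨zero_mem _, zero_mem _, hm⟩

theorem mixedBracket_inThd_left {m : M} (hm : m ∈ Z.deg 0) {φ : (L × N × M) →ₗ[𝕜] M}
    (hφ : φ (0, 0, m) = 0) (x : L × N × M) :
    mixedBracket Z φ (0, 0, m) x = -Z.bracket m (φ x) := by
  simp [mixedBracket, hφ, Grading.sgn_of_mem _ hm]

theorem mixedBracket_inThd_right {m : M} (hm : m ∈ Z.deg 0) {φ : (L × N × M) →ₗ[𝕜] M}
    (hφ : φ (0, 0, m) = 0) (x : L × N × M) :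
    mixedBracket Z φ x (0, 0, m) = -Z.bracket m (φ x) := by
  simp [mixedBracket, hφ, Z.bracket_zero_comm hm]

theorem coneSlope_inThd (h : X.Hom Z) (g : Y.Hom Z) (m : M) : coneSlope h g (0, 0, m) = 0 := by
  simp [coneSlope]

/-- A chain with one entry `(l, n, 0)` and all others equal to `m` vanishes unless that entry is
one of the two innermost ones. -/
theorem sum_chain_update (h : X.Hom Z) (g : Y.Hom Z) {m : M} (hm : m ∈ Z.deg 0) (l : L) (n : N)
    (k : ℕ) :
    ∑ p, chain h g k (Function.update (fun _ => (0, 0, m)) p (l, n, 0)) =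
      (2 * (-1 : 𝕜) ^ (k + 1)) • ((Z.bracket m) ^ (k + 1)) (coneSlope h g (l, n, 0)) := by
  induction k with
  | zero =>
    rw [Fin.sum_univ_two]
    change mixedBracket Z (coneSlope h g) (l, n, 0) (0, 0, m) +
      mixedBracket Z (coneSlope h g) (0, 0, m) (l, n, 0) = _
    rw [mixedBracket_inThd_left hm (coneSlope_inThd h g m),
      mixedBracket_inThd_right hm (coneSlope_inThd h g m)]
    simp only [zero_add, pow_one]
    module
  | succ k ih =>
    rw [Fin.sum_univ_succ]
    have h0 : chain h g (k + 1) (Function.update (fun _ => (0, 0, m)) 0 (l, n, 0)) = 0 := by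
      change coneAd L N Z (l, n, 0) _ = 0
      simp [coneAd]
    have hs : ∀ p : Fin (k + 2), chain h g (k + 1)
        (Function.update (fun _ => (0, 0, m)) p.succ (l, n, 0)) =
        -Z.bracket m (chain h g k (Function.update (fun _ => (0, 0, m)) p (l, n, 0))) := by
      intro p
      change coneAd L N Z (Function.update (fun _ => ((0, 0, m) : L × N × M)) p.succ (l, n, 0) 0)
        (chain h g k (Fin.tail (Function.update (fun _ => (0, 0, m)) p.succ (l, n, 0)))) = _
      rw [Fin.tail_update_succ, Function.update_of_ne (Fin.succ_ne_zero p).symm]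
      simp [coneAd, Grading.sgn_of_mem _ hm]
      rfl
    rw [h0, zero_add, Finset.sum_congr rfl fun p _ => hs p, Finset.sum_neg_distrib, ← map_sum, ih,
      map_smul, pow_succ' (Z.bracket m) (k + 1), Module.End.mul_apply]
    module

variable [CharZero 𝕜]

theorem coneBracket_succ_succ_succ_update (h : X.Hom Z) (g : Y.Hom Z) {m : M} (hm : m ∈ Z.deg 0)
    (l : L) (n : N) (k : ℕ) (q : Fin (k + 3)) :
    coneBracket h g (k + 3)
        (Function.update (fun _ => ((0, 0, m) : L × N × M)) q (l, n, 0)) =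
      ((0, 0, -(((bernoulli (k + 2) : ℚ) : 𝕜) •
        ((Z.bracket m) ^ (k + 2)) (coneSlope h g (l, n, 0)))) : L × N × M) := by
  rw [coneBracket, Contraction.bracket_update _ (k + 1) (inThd_mem hm), tree_succ]
  simp only [smul_apply, LinearMap.compMultilinearMap_apply]
  rw [← Finset.smul_sum, ← map_sum, sum_chain_update h g hm, ← map_smul, ← map_smul]
  refine congrArg (fun v : M => ((0, 0, v) : L × N × M)) ?_
  rw [smul_smul, smul_smul, ← neg_smul]
  rw [LinearMap.id_apply]
  congr 1
  have hf : (((k + 2).factorial : ℕ) : 𝕜) ≠ 0 := by exact_mod_cast Nat.factorial_ne_zero _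
  have hs : (-1 : 𝕜) ^ k * (-1) ^ k = 1 := by rw [← mul_pow]; simp
  field_simp
  linear_combination (-((bernoulli (k + 2) : ℚ) : 𝕜)) * hs

theorem coneBracket_two_update (h : X.Hom Z) (g : Y.Hom Z) {m : M} (hm : m ∈ Z.deg 0)
    (l : L) (n : N) (q : Fin 2) :
    coneBracket h g 2
        (Function.update (fun _ => ((0, 0, m) : L × N × M)) q (l, n, 0)) =
      ((0, 0, -((2 : 𝕜)⁻¹ • Z.bracket m (h.toLin l + g.toLin n))) : L × N × M) := by
  rw [coneBracket, Contraction.bracket_update _ 0 (inThd_mem hm), tree_zero, Fin.sum_univ_two]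
  change _ • (binaryTree h g (l, n, 0) (0, 0, m) + binaryTree h g (0, 0, m) (l, n, 0)) = _
  have e1 : binaryTree h g (l, n, 0) (0, 0, m) =
      (0, 0, -((2 : 𝕜)⁻¹ • Z.bracket m (h.toLin l + g.toLin n))) := by
    simp [binaryTree, mixedBracket_inThd_right hm, coneSlope]
    module
  have e2 : binaryTree h g (0, 0, m) (l, n, 0) =
      (0, 0, -((2 : 𝕜)⁻¹ • Z.bracket m (h.toLin l + g.toLin n))) := by
    simp [binaryTree, mixedBracket_inThd_left hm, coneSlope]
    module
  rw [e1, e2, ← two_smul 𝕜, smul_smul]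
  simp

theorem snoc_const_eq_update {C : Type*} {j : ℕ} (m x : C) :
    (Fin.snoc (α := fun _ => C) (fun _ : Fin j => m) x : Fin (j + 1) → C) =
      Function.update (fun _ => m) (Fin.last j) x := by
  ext1 i
  refine Fin.lastCases ?_ (fun i => ?_) i
  · simp
  · simp

end ExplicitBrackets

/-! ### Extension of scalars -/

section BaseChange

variable {𝕜 : Type*} [Field 𝕜] {V V' W U C : Type*} [AddCommGroup V] [Module 𝕜 V]
  [AddCommGroup V'] [Module 𝕜 V'] [AddCommGroup W] [Module 𝕜 W] [AddCommGroup U] [Module 𝕜 U]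
  [AddCommGroup C] [Module 𝕜 C]
  (A : Type*) [CommRing A] [Algebra 𝕜 A]

/-- The `A`-bilinear extension of a bilinear map. -/
noncomputable def bilinBaseChange (B : V →ₗ[𝕜] W →ₗ[𝕜] U) :
    A ⊗[𝕜] V →ₗ[A] A ⊗[𝕜] W →ₗ[A] A ⊗[𝕜] U :=
  (LinearMap.baseChangeHom 𝕜 A W U ∘ₗ B).liftBaseChange A

theorem bilinBaseChange_tmul (B : V →ₗ[𝕜] W →ₗ[𝕜] U) (a : A) (v : V) (y : A ⊗[𝕜] W) :
    bilinBaseChange A B (a ⊗ₜ v) y = a • (B v).baseChange A y := by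
  simp [bilinBaseChange]

theorem bilinBaseChange_add (B B' : V →ₗ[𝕜] W →ₗ[𝕜] U) (x : A ⊗[𝕜] V) (y : A ⊗[𝕜] W) :
    bilinBaseChange A (B + B') x y = bilinBaseChange A B x y + bilinBaseChange A B' x y := by
  induction x using TensorProduct.induction_on with
  | zero => simp
  | tmul a v => simp [bilinBaseChange_tmul, LinearMap.baseChange_add]
  | add x x' hx hx' => simp only [map_add, LinearMap.add_apply, hx, hx']; abel

theorem bilinBaseChange_smul (c : 𝕜) (B : V →ₗ[𝕜] W →ₗ[𝕜] U) (x : A ⊗[𝕜] V) (y : A ⊗[𝕜] W) :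
    bilinBaseChange A (c • B) x y = c • bilinBaseChange A B x y := by
  induction x using TensorProduct.induction_on with
  | zero => simp
  | tmul a v => simp [bilinBaseChange_tmul, LinearMap.baseChange_smul, smul_comm c a]
  | add x x' hx hx' => simp only [map_add, LinearMap.add_apply, hx, hx', smul_add]

theorem bilinBaseChange_compr₂ (B : V →ₗ[𝕜] W →ₗ[𝕜] U) (f : U →ₗ[𝕜] C) (x : A ⊗[𝕜] V)
    (y : A ⊗[𝕜] W) :
    bilinBaseChange A (B.compr₂ f) x y = f.baseChange A (bilinBaseChange A B x y) := by
  induction x using TensorProduct.induction_on with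
  | zero => simp
  | tmul a v =>
    have : (B.compr₂ f) v = f ∘ₗ B v := rfl
    simp [bilinBaseChange_tmul, this, LinearMap.baseChange_comp]
  | add x x' hx hx' => simp only [map_add, LinearMap.add_apply, hx, hx']

theorem bilinBaseChange_compl₁₂ (B : V →ₗ[𝕜] V →ₗ[𝕜] U) (f : W →ₗ[𝕜] V) (k : C →ₗ[𝕜] V)
    (x : A ⊗[𝕜] W) (y : A ⊗[𝕜] C) :
    bilinBaseChange A (B.compl₁₂ f k) x y =
      LinearMap.BilinMap.baseChange A B (f.baseChange A x) (k.baseChange A y) := by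
  induction x using TensorProduct.induction_on with
  | zero => simp
  | tmul a v =>
    induction y using TensorProduct.induction_on with
    | zero => simp
    | tmul b w =>
      simp [bilinBaseChange_tmul, TensorProduct.smul_tmul']
    | add y y' hy hy' => simp only [map_add, hy, hy']
  | add x x' hx hx' => simp only [map_add, LinearMap.add_apply, hx, hx']

theorem extend_comp {n : ℕ} (f : V →ₗ[𝕜] W) (T : MultilinearMap 𝕜 (fun _ : Fin n => C) V)
    (γ : Fin n → A ⊗[𝕜] C) :
    extend A n (f.compMultilinearMap T) γ = f.baseChange A (extend A n T γ) := by
  induction n with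
  | zero => simp [extend]
  | succ n ih =>
    rw [extend_succ, extend_succ]
    generalize Fin.tail γ = δ
    induction γ 0 using TensorProduct.induction_on with
    | zero => simp
    | tmul a v =>
      have := ih (T.curryLeft v) δ
      simp only [LinearMap.liftBaseChange_tmul, smul_apply, LinearMap.comp_apply, map_smul]
      rw [← this]
      rfl
    | add x y hx hy => simp only [map_add, add_apply, hx, hy]

theorem extend_consMap {n : ℕ} (B : C →ₗ[𝕜] V →ₗ[𝕜] U)
    (T : MultilinearMap 𝕜 (fun _ : Fin n => C) V) (γ : Fin (n + 1) → A ⊗[𝕜] C) :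
    extend A (n + 1) (consMap B T) γ =
      bilinBaseChange A B (γ 0) (extend A n T (Fin.tail γ)) := by
  rw [extend_succ]
  generalize Fin.tail γ = δ
  induction γ 0 using TensorProduct.induction_on with
  | zero => simp
  | tmul a v =>
    have hB : (consMap B T).curryLeft v = (B v).compMultilinearMap T := rfl
    rw [bilinBaseChange_tmul, LinearMap.liftBaseChange_tmul, smul_apply, LinearMap.comp_apply,
      hB, extend_comp]
  | add x y hx hy => simp only [map_add, add_apply, LinearMap.add_apply, hx, hy]

theorem extend_ofSubsingleton (f : V →ₗ[𝕜] W) (γ : Fin 1 → A ⊗[𝕜] V) :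
    extend A 1 (MultilinearMap.ofSubsingleton 𝕜 V W (0 : Fin 1) f) γ = f.baseChange A (γ 0) := by
  rw [extend_succ]
  induction γ 0 using TensorProduct.induction_on with
  | zero => simp
  | tmul a v =>
    simp [extend, TensorProduct.smul_tmul']
  | add x y hx hy => simp only [map_add, add_apply, hx, hy]

/-- Multilinear maps over `A` out of `A ⊗ V` are determined by their values on `1 ⊗ v`. -/
theorem multilinearMap_ext_one_tmul {P : Type*} [AddCommGroup P] [Module A P] {n : ℕ}
    {S T : MultilinearMap A (fun _ : Fin n => A ⊗[𝕜] V) P}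
    (h : ∀ v : Fin n → V, S (fun i => 1 ⊗ₜ v i) = T (fun i => 1 ⊗ₜ v i)) : S = T := by
  induction n with
  | zero => ext γ; rw [Subsingleton.elim γ fun i => 1 ⊗ₜ (0 : V)]; exact h fun _ => 0
  | succ n ih =>
    have hc : ∀ x, S.curryLeft x = T.curryLeft x := by
      intro x
      induction x using TensorProduct.induction_on with
      | zero => simp
      | tmul a v =>
        have h1 : S.curryLeft (1 ⊗ₜ v) = T.curryLeft (1 ⊗ₜ v) := by
          refine ih fun w => ?_
          have hcons : (Fin.cons (1 ⊗ₜ v) fun i => 1 ⊗ₜ w i : Fin (n + 1) → A ⊗[𝕜] V) =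
              fun i => 1 ⊗ₜ (Fin.cons v w : Fin (n + 1) → V) i := by
            ext i
            refine Fin.cases ?_ (fun i => ?_) i <;> simp
          rw [MultilinearMap.curryLeft_apply, MultilinearMap.curryLeft_apply, hcons]
          exact h _
        have ha : a ⊗ₜ[𝕜] v = a • ((1 : A) ⊗ₜ[𝕜] v) := by simp [TensorProduct.smul_tmul']
        rw [ha, map_smul, map_smul, h1]
      | add x y hx hy => rw [map_add, map_add, hx, hy]
    ext γ
    rw [← Fin.cons_self_tail γ]
    exact congrArg (fun F => F (Fin.tail γ)) (hc (γ 0))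

theorem extend_domDomCongr {n : ℕ} (T : MultilinearMap 𝕜 (fun _ : Fin n => V) W)
    (σ : Equiv.Perm (Fin n)) (γ : Fin n → A ⊗[𝕜] V) :
    extend A n (T.domDomCongr σ) γ = extend A n T (fun i => γ (σ i)) := by
  have : extend A n (T.domDomCongr σ) = (extend A n T).domDomCongr σ := by
    refine multilinearMap_ext_one_tmul A fun v => ?_
    rw [extend_tmul, MultilinearMap.domDomCongr_apply, MultilinearMap.domDomCongr_apply,
      extend_tmul]
  rw [this]; rfl

theorem extend_compLinearMap {n : ℕ} (T : MultilinearMap 𝕜 (fun _ : Fin n => V) W)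
    (f : Fin n → C →ₗ[𝕜] V) (γ : Fin n → A ⊗[𝕜] C) :
    extend A n (T.compLinearMap f) γ = extend A n T (fun i => (f i).baseChange A (γ i)) := by
  have : extend A n (T.compLinearMap f) =
      (extend A n T).compLinearMap fun i => (f i).baseChange A := by
    refine multilinearMap_ext_one_tmul A fun v => ?_
    rw [extend_tmul, MultilinearMap.compLinearMap_apply, MultilinearMap.compLinearMap_apply]
    simp only [LinearMap.baseChange_tmul]
    rw [extend_tmul]
  rw [this]; rfl

end BaseChange

/-! ### Truncated power series in a nilpotent operator -/

section PowerSeries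

/-- Evaluation of truncated power series at an element of vanishing `N`-th power is
multiplicative. -/
theorem aeval_trunc_mul {𝕜 S : Type*} [Field 𝕜] [Ring S] [Algebra 𝕜 S] {a : S} {N : ℕ}
    (ha : a ^ N = 0) (f g : PowerSeries 𝕜) :
    Polynomial.aeval a (f.trunc N) * Polynomial.aeval a (g.trunc N) =
      Polynomial.aeval a ((f * g).trunc N) := by
  rw [← map_mul, ← sub_eq_zero, ← map_sub]
  have hdvd : (Polynomial.X : 𝕜[X]) ^ N ∣ f.trunc N * g.trunc N - (f * g).trunc N := by
    rw [Polynomial.X_pow_dvd_iff]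
    intro d hd
    rw [← PowerSeries.trunc_trunc_mul_trunc, Polynomial.coeff_sub, PowerSeries.coeff_trunc,
      if_pos hd, ← Polynomial.coe_mul, Polynomial.coeff_coe, sub_self]
  obtain ⟨r, hr⟩ := hdvd
  rw [hr, map_mul, map_pow, Polynomial.aeval_X, ha, zero_mul]

theorem aeval_trunc_apply {𝕜 A P : Type*} [Field 𝕜] [CommRing A] [Algebra 𝕜 A] [AddCommGroup P]
    [Module A P] [Module 𝕜 P] [IsScalarTower 𝕜 A P] (a : Module.End A P) (f : PowerSeries 𝕜)
    (N : ℕ) (x : P) :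
    Polynomial.aeval a (f.trunc N) x =
      ∑ i ∈ Finset.range N, PowerSeries.coeff i f • (a ^ i) x := by
  rw [PowerSeries.trunc_apply, map_sum, LinearMap.sum_apply, Nat.Ico_zero_eq_range]
  refine Finset.sum_congr rfl fun i _ => ?_
  rw [Polynomial.aeval_monomial, Module.End.mul_apply, Module.algebraMap_end_apply]

variable (𝕜 : Type*) [Field 𝕜] [CharZero 𝕜]

/-- The power series `(e^x - 1) / x`. -/
noncomputable def expQuotient : PowerSeries 𝕜 :=
  PowerSeries.mk fun n => (((n + 1).factorial : ℕ) : 𝕜)⁻¹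

theorem bernoulliPowerSeries_mul_expQuotient :
    bernoulliPowerSeries 𝕜 * expQuotient 𝕜 = 1 := by
  have h : PowerSeries.exp 𝕜 - 1 = PowerSeries.X * expQuotient 𝕜 := by
    ext n
    rcases n with _ | n
    · simp
    · rw [PowerSeries.coeff_succ_X_mul]
      simp [PowerSeries.coeff_one, expQuotient, PowerSeries.coeff_exp]
  have := bernoulliPowerSeries_mul_exp_sub_one 𝕜
  rw [h, mul_left_comm] at this
  exact mul_left_cancel₀ PowerSeries.X_ne_zero (this.trans (mul_one _).symm)

end PowerSeries

/-! ### Coefficients in an Artinian algebra -/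

section Coefficients

variable {𝕜 : Type*} [Field 𝕜] {V W : Type*} [AddCommGroup V] [Module 𝕜 V]
  [AddCommGroup W] [Module 𝕜 W] {A : Type*} [CommRing A] [IsLocalRing A] [Algebra 𝕜 A]

@[elab_as_elim]
theorem coeff_induction (G : Grading 𝕜 V) {i : ℤ} {P : A ⊗[𝕜] V → Prop} {x : A ⊗[𝕜] V}
    (hx : x ∈ G.coeff A i) (h0 : P 0)
    (ht : ∀ a ∈ IsLocalRing.maximalIdeal A, ∀ v ∈ G.deg i, P (a ⊗ₜ v))
    (hadd : ∀ x y, P x → P y → P (x + y)) : P x := by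
  obtain ⟨y, rfl⟩ := hx
  induction y using TensorProduct.induction_on with
  | zero => simpa using h0
  | tmul a v => exact ht a a.2 v v.2
  | add y z hy hz => rw [map_add]; exact hadd _ _ hy hz

theorem tmul_mem_coeff (G : Grading 𝕜 V) {i : ℤ} {a : A} (ha : a ∈ IsLocalRing.maximalIdeal A)
    {v : V} (hv : v ∈ G.deg i) : a ⊗ₜ v ∈ G.coeff A i :=
  ⟨⟨a, ha⟩ ⊗ₜ ⟨v, hv⟩, rfl⟩

theorem baseChange_congr_of_mem_coeff (G : Grading 𝕜 V) {i : ℤ} {f f' : V →ₗ[𝕜] W}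
    (h : ∀ v ∈ G.deg i, f v = f' v) {x : A ⊗[𝕜] V} (hx : x ∈ G.coeff A i) :
    f.baseChange A x = f'.baseChange A x := by
  refine coeff_induction G hx (by simp) (fun a _ v hv => ?_) (fun x y hx hy => ?_)
  · simp [h v hv]
  · rw [map_add, map_add, hx, hy]

theorem baseChange_mem_coeff (G : Grading 𝕜 V) (G' : Grading 𝕜 W) {i j : ℤ} {f : V →ₗ[𝕜] W}
    (h : ∀ v ∈ G.deg i, f v ∈ G'.deg j) {x : A ⊗[𝕜] V} (hx : x ∈ G.coeff A i) :
    f.baseChange A x ∈ G'.coeff A j := by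
  refine coeff_induction G hx (by simp) (fun a ha v hv => ?_) (fun x y hx hy => ?_)
  · exact tmul_mem_coeff G' ha (h v hv)
  · rw [map_add]; exact add_mem hx hy

theorem baseChange_sgn_of_even (G : Grading 𝕜 V) {x : A ⊗[𝕜] V} (hx : x ∈ G.coeff A 0) :
    G.sgn.baseChange A x = x := by
  rw [baseChange_congr_of_mem_coeff G (f' := LinearMap.id)
    (fun v hv => by simp [G.sgn_of_mem hv]) hx]
  simp

theorem baseChange_sgn_of_odd (G : Grading 𝕜 V) {x : A ⊗[𝕜] V} (hx : x ∈ G.coeff A 1) :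
    G.sgn.baseChange A x = -x := by
  rw [baseChange_congr_of_mem_coeff G (f' := -LinearMap.id)
    (fun v hv => by simp [G.sgn_of_mem hv]) hx]
  simp

theorem baseChange_parityProj (G : Grading 𝕜 V) {x : A ⊗[𝕜] V} (hx : x ∈ G.coeff A 1)
    (e : ZMod 2) : (G.parityProj (e + 1)).baseChange A x = if e = 0 then x else 0 := by
  split_ifs with he
  · rw [baseChange_congr_of_mem_coeff G (f' := LinearMap.id)
      (fun v hv => by rw [G.parityProj_of_mem hv, if_pos he, LinearMap.id_apply]) hx]
    simp
  · rw [baseChange_congr_of_mem_coeff G (f' := 0)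
      (fun v hv => by rw [G.parityProj_of_mem hv, if_neg he, LinearMap.zero_apply]) hx]
    simp

theorem DGLA.bracketA_zero_comm (Z : DGLA 𝕜 V) {m : A ⊗[𝕜] V} (hm : m ∈ Z.coeff A 0)
    (y : A ⊗[𝕜] V) : Z.bracketA A y m = -Z.bracketA A m y := by
  induction y using TensorProduct.induction_on with
  | zero => simp
  | tmul b w =>
    refine coeff_induction Z.toGrading hm (by simp) (fun a _ v hv => ?_) (fun x y hx hy => ?_)
    · simp [DGLA.bracketA, Z.bracket_zero_comm hv, mul_comm a b, TensorProduct.tmul_neg]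
    · rw [map_add, map_add, LinearMap.add_apply, hx, hy, neg_add]
  | add x y hx hy => rw [map_add, map_add, LinearMap.add_apply, hx, hy, neg_add]

/-- On the powers of one element of degree one, all terms of the symmetrization coincide. -/
theorem Contraction.extend_bracket_const {C : Type*} [AddCommGroup C] [Module 𝕜 C]
    {X : DGLA 𝕜 V} {G : Grading 𝕜 C} {D : C →ₗ[𝕜] C} (T : Contraction X G D) (n : ℕ)
    {γ : A ⊗[𝕜] C} (hγ : γ ∈ G.coeff A 1) :
    extend A (n + 2) (T.bracket (n + 2)) (fun _ => γ) =
      ((-1 : 𝕜) ^ n / 2 * ((n + 2).factorial : ℕ)) • extend A (n + 2) (T.tree n) (fun _ => γ) := by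
  have hσ : ∀ σ : Equiv.Perm (Fin (n + 2)), (∑ e : Fin (n + 2) → ZMod 2, koszulSign 𝕜 σ e •
      extend A (n + 2) (((T.tree n).domDomCongr σ).compLinearMap
        fun i => G.parityProj (e i + 1)) (fun _ => γ)) =
      extend A (n + 2) (T.tree n) (fun _ => γ) := by
    intro σ
    rw [Finset.sum_eq_single 0]
    · have h1 := koszulSign_single (𝕜 := 𝕜) σ 0 0
      rw [Pi.single_zero] at h1
      rw [h1, one_smul, extend_compLinearMap, extend_domDomCongr]
      congr 1
      ext1 i
      rw [baseChange_parityProj G hγ]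
      simp
    · intro e _ he
      obtain ⟨i, hi⟩ := Function.ne_iff.mp he
      rw [extend_compLinearMap, MultilinearMap.map_coord_zero _ i, smul_zero]
      rw [baseChange_parityProj G hγ]
      exact if_neg hi
    · simp
  change extend A (n + 2) (((-1 : 𝕜) ^ n / 2) • ∑ σ : Equiv.Perm (Fin (n + 2)),
    ∑ e : Fin (n + 2) → ZMod 2, koszulSign 𝕜 σ e •
      ((T.tree n).domDomCongr σ).compLinearMap fun i => G.parityProj (e i + 1)) _ = _
  simp only [map_smul, map_sum, smul_apply, sum_apply]
  rw [Finset.sum_congr rfl fun σ _ => hσ σ, Finset.sum_const, Finset.card_univ,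
    Fintype.card_perm, Fintype.card_fin, ← Nat.cast_smul_eq_nsmul 𝕜, smul_smul]

end Coefficients

/-! ### Trees on elements of the cone with coefficients -/

section ConeElements

variable {𝕜 : Type*} [Field 𝕜] {L N M : Type v} [AddCommGroup L] [Module 𝕜 L]
  [AddCommGroup N] [Module 𝕜 N] [AddCommGroup M] [Module 𝕜 M]
  {X : DGLA 𝕜 L} {Y : DGLA 𝕜 N} {Z : DGLA 𝕜 M}

section Algebra

variable {A : Type u} [CommRing A] [Algebra 𝕜 A]

theorem baseChange_baseChange {V W U : Type*} [AddCommGroup V] [Module 𝕜 V] [AddCommGroup W]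
    [Module 𝕜 W] [AddCommGroup U] [Module 𝕜 U] (f : W →ₗ[𝕜] U) (k : V →ₗ[𝕜] W) (x : A ⊗[𝕜] V) :
    f.baseChange A (k.baseChange A x) = (f ∘ₗ k).baseChange A x := by
  rw [LinearMap.baseChange_comp]; rfl

@[simp] theorem coneFst_coneElt (l : A ⊗[𝕜] L) (n : A ⊗[𝕜] N) (m : A ⊗[𝕜] M) :
    (coneFst 𝕜 L N M).baseChange A (coneElt A l n m) = l := by
  have h1 : coneFst 𝕜 L N M ∘ₗ LinearMap.inl 𝕜 L (N × M) = LinearMap.id := rfl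
  have h2 : coneFst 𝕜 L N M ∘ₗ LinearMap.inr 𝕜 L (N × M) ∘ₗ LinearMap.inl 𝕜 N M = 0 := rfl
  have h3 : coneFst 𝕜 L N M ∘ₗ LinearMap.inr 𝕜 L (N × M) ∘ₗ LinearMap.inr 𝕜 N M = 0 := rfl
  rw [coneElt, map_add, map_add, baseChange_baseChange, baseChange_baseChange,
    baseChange_baseChange, h1, h2, h3]
  simp

@[simp] theorem coneSnd_coneElt (l : A ⊗[𝕜] L) (n : A ⊗[𝕜] N) (m : A ⊗[𝕜] M) :
    (coneSnd 𝕜 L N M).baseChange A (coneElt A l n m) = n := by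
  have h1 : coneSnd 𝕜 L N M ∘ₗ LinearMap.inl 𝕜 L (N × M) = 0 := rfl
  have h2 : coneSnd 𝕜 L N M ∘ₗ LinearMap.inr 𝕜 L (N × M) ∘ₗ LinearMap.inl 𝕜 N M =
    LinearMap.id := rfl
  have h3 : coneSnd 𝕜 L N M ∘ₗ LinearMap.inr 𝕜 L (N × M) ∘ₗ LinearMap.inr 𝕜 N M = 0 := rfl
  rw [coneElt, map_add, map_add, baseChange_baseChange, baseChange_baseChange,
    baseChange_baseChange, h1, h2, h3]
  simp

@[simp] theorem coneThd_coneElt (l : A ⊗[𝕜] L) (n : A ⊗[𝕜] N) (m : A ⊗[𝕜] M) :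
    (coneThd 𝕜 L N M).baseChange A (coneElt A l n m) = m := by
  have h1 : coneThd 𝕜 L N M ∘ₗ LinearMap.inl 𝕜 L (N × M) = 0 := rfl
  have h2 : coneThd 𝕜 L N M ∘ₗ LinearMap.inr 𝕜 L (N × M) ∘ₗ LinearMap.inl 𝕜 N M = 0 := rfl
  have h3 : coneThd 𝕜 L N M ∘ₗ LinearMap.inr 𝕜 L (N × M) ∘ₗ LinearMap.inr 𝕜 N M =
    LinearMap.id := rfl
  rw [coneElt, map_add, map_add, baseChange_baseChange, baseChange_baseChange,
    baseChange_baseChange, h1, h2, h3]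
  simp

theorem coneElt_proj (γ : A ⊗[𝕜] (L × N × M)) :
    coneElt A ((coneFst 𝕜 L N M).baseChange A γ) ((coneSnd 𝕜 L N M).baseChange A γ)
      ((coneThd 𝕜 L N M).baseChange A γ) = γ := by
  rw [coneElt, baseChange_baseChange, baseChange_baseChange, baseChange_baseChange,
    ← LinearMap.add_apply, ← LinearMap.add_apply, ← LinearMap.baseChange_add,
    ← LinearMap.baseChange_add]
  have : LinearMap.inl 𝕜 L (N × M) ∘ₗ coneFst 𝕜 L N M +
      (LinearMap.inr 𝕜 L (N × M) ∘ₗ LinearMap.inl 𝕜 N M) ∘ₗ coneSnd 𝕜 L N M +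
      (LinearMap.inr 𝕜 L (N × M) ∘ₗ LinearMap.inr 𝕜 N M) ∘ₗ coneThd 𝕜 L N M = LinearMap.id := by
    ext <;> simp
  rw [this]; simp

theorem coneElt_add (l l' : A ⊗[𝕜] L) (n n' : A ⊗[𝕜] N) (m m' : A ⊗[𝕜] M) :
    coneElt A l n m + coneElt A l' n' m' = coneElt A (l + l') (n + n') (m + m') := by
  simp only [coneElt, map_add]; abel

theorem coneElt_smul (c : 𝕜) (l : A ⊗[𝕜] L) (n : A ⊗[𝕜] N) (m : A ⊗[𝕜] M) :
    c • coneElt A l n m = coneElt A (c • l) (c • n) (c • m) := by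
  simp only [coneElt, LinearMap.map_smul_of_tower, smul_add]

theorem coneElt_zero_zero (m : A ⊗[𝕜] M) :
    coneElt A (0 : A ⊗[𝕜] L) (0 : A ⊗[𝕜] N) m = (inThd 𝕜 L N M).baseChange A m := by
  simp [coneElt]

theorem coneElt_eq_zero {l : A ⊗[𝕜] L} {n : A ⊗[𝕜] N} {m : A ⊗[𝕜] M} :
    coneElt A l n m = 0 ↔ l = 0 ∧ n = 0 ∧ m = 0 := by
  constructor
  · intro h0
    have h1 := coneFst_coneElt l n m
    have h2 := coneSnd_coneElt l n m
    have h3 := coneThd_coneElt l n m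
    rw [h0, map_zero] at h1 h2 h3
    exact ⟨h1.symm, h2.symm, h3.symm⟩
  · rintro ⟨rfl, rfl, rfl⟩
    simp [coneElt]

theorem coneSlope_coneElt (h : X.Hom Z) (g : Y.Hom Z) (l : A ⊗[𝕜] L) (n : A ⊗[𝕜] N)
    (m : A ⊗[𝕜] M) : (coneSlope h g).baseChange A (coneElt A l n m) =
      h.toLin.baseChange A l - g.toLin.baseChange A n := by
  rw [coneSlope, LinearMap.baseChange_sub, LinearMap.sub_apply, ← baseChange_baseChange,
    ← baseChange_baseChange, coneFst_coneElt, coneSnd_coneElt]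

theorem coneD_coneElt (h : X.Hom Z) (g : Y.Hom Z) (l : A ⊗[𝕜] L) (n : A ⊗[𝕜] N)
    (m : A ⊗[𝕜] M) : (coneD h g).baseChange A (coneElt A l n m) =
      coneElt A (X.dA A l) (Y.dA A n) (-Z.dA A m + (h.toLin.baseChange A l -
        g.toLin.baseChange A n)) := by
  have h1 : coneFst 𝕜 L N M ∘ₗ coneD h g = X.d ∘ₗ coneFst 𝕜 L N M := rfl
  have h2 : coneSnd 𝕜 L N M ∘ₗ coneD h g = Y.d ∘ₗ coneSnd 𝕜 L N M := rfl
  have h3 : coneThd 𝕜 L N M ∘ₗ coneD h g = -(Z.d ∘ₗ coneThd 𝕜 L N M) + coneSlope h g := by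
    refine LinearMap.ext fun c => ?_
    change -Z.d c.2.2 - g.toLin c.2.1 + h.toLin c.1 = -Z.d c.2.2 + (h.toLin c.1 - g.toLin c.2.1)
    abel
  rw [← coneElt_proj ((coneD h g).baseChange A (coneElt A l n m)), baseChange_baseChange,
    baseChange_baseChange, baseChange_baseChange, h1, h2, h3, LinearMap.baseChange_add,
    LinearMap.baseChange_neg, LinearMap.add_apply, LinearMap.neg_apply,
    ← baseChange_baseChange X.d (coneFst 𝕜 L N M), ← baseChange_baseChange Y.d (coneSnd 𝕜 L N M),
    ← baseChange_baseChange Z.d (coneThd 𝕜 L N M), coneFst_coneElt, coneSnd_coneElt,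
    coneThd_coneElt, coneSlope_coneElt]
  rfl

end Algebra

variable {A : Type u} [CommRing A] [IsLocalRing A] [Algebra 𝕜 A]

theorem coneElt_mem_coeff {l : A ⊗[𝕜] L} {n : A ⊗[𝕜] N} {m : A ⊗[𝕜] M}
    (hl : l ∈ X.coeff A 1) (hn : n ∈ Y.coeff A 1) (hm : m ∈ Z.coeff A 0) :
    coneElt A l n m ∈ (coneGrading X Y Z).coeff A 1 :=
  add_mem (add_mem
    (baseChange_mem_coeff X.toGrading (coneGrading X Y Z) (j := 1)
      (fun _ hv => ⟨hv, zero_mem _, zero_mem _⟩) hl)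
    (baseChange_mem_coeff Y.toGrading (coneGrading X Y Z) (j := 1)
      (fun _ hv => ⟨zero_mem _, hv, zero_mem _⟩) hn))
    (baseChange_mem_coeff Z.toGrading (coneGrading X Y Z) (i := 0) (j := 1)
      (f := inThd 𝕜 L N M) (fun _ hv => inThd_mem hv) hm)

theorem mixedBracket_coneElt (φ : (L × N × M) →ₗ[𝕜] M) {l : A ⊗[𝕜] L} {n : A ⊗[𝕜] N}
    {m : A ⊗[𝕜] M} (hm : m ∈ Z.coeff A 0) :
    bilinBaseChange A (mixedBracket Z φ) (coneElt A l n m) (coneElt A l n m) =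
      (-2 : 𝕜) • Z.bracketA A m (φ.baseChange A (coneElt A l n m)) := by
  rw [mixedBracket, sub_eq_add_neg, ← neg_one_smul 𝕜, bilinBaseChange_add, bilinBaseChange_smul,
    bilinBaseChange_compl₁₂, bilinBaseChange_compl₁₂,
    ← baseChange_baseChange Z.sgn (coneThd 𝕜 L N M), coneThd_coneElt,
    baseChange_sgn_of_even _ hm]
  change Z.bracketA A _ m + (-1 : 𝕜) • Z.bracketA A m _ = _
  rw [Z.bracketA_zero_comm hm]
  module

/-- On equal arguments the two terms of the innermost bracket coincide, whence the factor `2`. -/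
theorem extend_chain (h : X.Hom Z) (g : Y.Hom Z) {l : A ⊗[𝕜] L} {n : A ⊗[𝕜] N}
    {m : A ⊗[𝕜] M} (hm : m ∈ Z.coeff A 0) (k : ℕ) :
    extend A (k + 2) (chain h g k) (fun _ => coneElt A l n m) =
      (2 * (-1 : 𝕜) ^ (k + 1)) • ((Z.bracketA A m) ^ (k + 1))
        (h.toLin.baseChange A l - g.toLin.baseChange A n) := by
  induction k with
  | zero =>
    rw [chain, extend_consMap, extend_ofSubsingleton, LinearMap.baseChange_id,
      LinearMap.id_apply]
    change bilinBaseChange A _ (coneElt A l n m) (coneElt A l n m) = _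
    rw [mixedBracket_coneElt _ hm, coneSlope_coneElt]
    simp
  | succ k ih =>
    have hAd : coneAd L N Z =
        (-1 : 𝕜) • Z.bracket.compl₁₂ (Z.sgn ∘ₗ coneThd 𝕜 L N M) LinearMap.id := by
      refine LinearMap.ext fun c => LinearMap.ext fun v => ?_
      simp [coneAd]
    rw [chain, extend_consMap]
    change bilinBaseChange A _ (coneElt A l n m)
      (extend A (k + 2) (chain h g k) fun _ => coneElt A l n m) = _
    rw [ih, hAd, bilinBaseChange_smul, bilinBaseChange_compl₁₂,
      ← baseChange_baseChange Z.sgn (coneThd 𝕜 L N M), coneThd_coneElt, baseChange_sgn_of_even _ hm, LinearMap.baseChange_id, LinearMap.id_apply,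
      LinearMap.map_smul_of_tower, smul_smul, pow_succ' (Z.bracketA A m) (k + 1),
      Module.End.mul_apply, pow_succ _ (k + 1)]
    congr 1
    ring

theorem binaryTree_coneElt (h : X.Hom Z) (g : Y.Hom Z) {l : A ⊗[𝕜] L} {n : A ⊗[𝕜] N}
    {m : A ⊗[𝕜] M} (hl : l ∈ X.coeff A 1) (hn : n ∈ Y.coeff A 1) (hm : m ∈ Z.coeff A 0) :
    bilinBaseChange A (binaryTree h g) (coneElt A l n m) (coneElt A l n m) =
      coneElt A (-X.bracketA A l l) (-Y.bracketA A n n)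
        ((-2 : 𝕜) • Z.bracketA A m (g.toLin.baseChange A n) +
          (2 : 𝕜)⁻¹ • (-2 : 𝕜) • Z.bracketA A m
            (h.toLin.baseChange A l - g.toLin.baseChange A n)) := by
  have hX : X.q₂.compl₁₂ (coneFst 𝕜 L N M) (coneFst 𝕜 L N M) =
    X.bracket.compl₁₂ (X.sgn ∘ₗ coneFst 𝕜 L N M) (coneFst 𝕜 L N M) := rfl
  have hY : Y.q₂.compl₁₂ (coneSnd 𝕜 L N M) (coneSnd 𝕜 L N M) =
    Y.bracket.compl₁₂ (Y.sgn ∘ₗ coneSnd 𝕜 L N M) (coneSnd 𝕜 L N M) := rfl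
  rw [binaryTree, hX, hY, bilinBaseChange_add, bilinBaseChange_add, bilinBaseChange_compr₂,
    bilinBaseChange_compr₂, bilinBaseChange_compr₂, bilinBaseChange_compl₁₂,
    bilinBaseChange_compl₁₂, bilinBaseChange_add, bilinBaseChange_smul,
    mixedBracket_coneElt _ hm, mixedBracket_coneElt _ hm, coneSlope_coneElt,
    ← baseChange_baseChange X.sgn (coneFst 𝕜 L N M),
    ← baseChange_baseChange Y.sgn (coneSnd 𝕜 L N M),
    ← baseChange_baseChange g.toLin (coneSnd 𝕜 L N M), coneFst_coneElt, coneSnd_coneElt, baseChange_sgn_of_odd _ hl, baseChange_sgn_of_odd _ hn, map_neg, map_neg]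
  rfl

end ConeElements

/-! ### The Maurer-Cartan equation of the cone -/

section MaurerCartan

open IsLocalRing

variable {𝕜 : Type*} [Field 𝕜] {L N M : Type v} [AddCommGroup L] [Module 𝕜 L]
  [AddCommGroup N] [Module 𝕜 N] [AddCommGroup M] [Module 𝕜 M]
  {X : DGLA 𝕜 L} {Y : DGLA 𝕜 N} {Z : DGLA 𝕜 M}

theorem finsum_eq_sum_range {P : Type*} [AddCommMonoid P] {F : ℕ → P} {N : ℕ}
    (hF : ∀ n, N ≤ n → F n = 0) : ∑ᶠ n, F n = ∑ n ∈ Finset.range N, F n := by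
  refine finsum_eq_sum_of_support_subset _ fun n hn => ?_
  rw [Finset.coe_range]
  by_contra h
  exact hn (hF n (not_lt.1 h))

theorem eq_zero_of_mem_pow_smul_top {A P : Type*} [CommRing A] [AddCommGroup P] [Module A P]
    {I : Ideal A} {N n : ℕ} (hN : I ^ N = ⊥) (hn : N ≤ n) {x : P}
    (hx : x ∈ I ^ n • (⊤ : Submodule A P)) : x = 0 := by
  have h0 : I ^ n = ⊥ := by
    rw [eq_bot_iff, ← hN]; exact Ideal.pow_le_pow_right hn
  rwa [h0, Submodule.bot_smul, Submodule.mem_bot] at hx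

theorem bracketA_pow_eq_zero {A : ArtAlg.{u} 𝕜} {N : ℕ} (hN : maximalIdeal A ^ N = ⊥)
    {m : A ⊗[𝕜] M} (hm : m ∈ Z.coeff A 0) {j : ℕ} (hj : N ≤ j) : Z.bracketA A m ^ j = 0 :=
  LinearMap.ext fun x =>
    eq_zero_of_mem_pow_smul_top hN hj (bracketA_pow_mem Z (coeff_le_smul_top _ _ hm) x j)

theorem gauge_eq_sum_range {A : ArtAlg.{u} 𝕜} {N : ℕ} (hN : maximalIdeal A ^ N = ⊥)
    {m : A ⊗[𝕜] M} (hm : m ∈ Z.coeff A 0) (x : A ⊗[𝕜] M) :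
    Z.gauge A m x = x + ∑ j ∈ Finset.range N, (((j + 1).factorial : ℕ) : 𝕜)⁻¹ •
      (Z.bracketA A m ^ j) (Z.bracketA A m x - Z.dA A m) := by
  rw [DGLA.gauge, finsum_eq_sum_range fun j hj => ?_]
  rw [bracketA_pow_eq_zero hN hm hj]
  simp

variable [CharZero 𝕜]

/-- The operators `a / (e^a - 1)` and `(e^a - 1) / a` are inverse to each other. -/
theorem bernoulli_sum_eq_neg_iff {A P : Type*} [CommRing A] [Algebra 𝕜 A] [AddCommGroup P]
    [Module A P] [Module 𝕜 P] [IsScalarTower 𝕜 A P] {a : Module.End A P} {N : ℕ}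
    (ha : a ^ N = 0) (u w : P) :
    ∑ j ∈ Finset.range N, (((j.factorial : ℕ) : 𝕜)⁻¹ * ((bernoulli j : ℚ) : 𝕜)) • (a ^ j) u =
        -w ↔
      u = -∑ j ∈ Finset.range N, (((j + 1).factorial : ℕ) : 𝕜)⁻¹ • (a ^ j) w := by
  have hB : ∑ j ∈ Finset.range N,
      (((j.factorial : ℕ) : 𝕜)⁻¹ * ((bernoulli j : ℚ) : 𝕜)) • (a ^ j) u =
      Polynomial.aeval a ((bernoulliPowerSeries 𝕜).trunc N) u := by
    rw [aeval_trunc_apply]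
    refine Finset.sum_congr rfl fun j _ => ?_
    rw [bernoulliPowerSeries, PowerSeries.coeff_mk]
    congr 1
    simp [div_eq_inv_mul]
  have hE : ∑ j ∈ Finset.range N, (((j + 1).factorial : ℕ) : 𝕜)⁻¹ • (a ^ j) w =
      Polynomial.aeval a ((expQuotient 𝕜).trunc N) w := by
    rw [aeval_trunc_apply]
    refine Finset.sum_congr rfl fun j _ => ?_
    rw [expQuotient, PowerSeries.coeff_mk]
  have hone : Polynomial.aeval a ((1 : PowerSeries 𝕜).trunc N) = 1 := by
    rcases N with _ | N
    · rw [pow_zero] at ha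
      exact (eq_zero_of_zero_eq_one ha.symm _).trans (eq_zero_of_zero_eq_one ha.symm _).symm
    · rw [PowerSeries.trunc_one, map_one]
  have hBE := aeval_trunc_mul ha (bernoulliPowerSeries 𝕜) (expQuotient 𝕜)
  have hEB := aeval_trunc_mul ha (expQuotient 𝕜) (bernoulliPowerSeries 𝕜)
  rw [mul_comm (expQuotient 𝕜)] at hEB
  rw [bernoulliPowerSeries_mul_expQuotient, hone] at hBE hEB
  rw [hB, hE, ← map_neg]
  constructor
  · intro h
    rw [← h, ← Module.End.mul_apply, hEB, Module.End.one_apply]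
  · intro h
    rw [h, ← Module.End.mul_apply, hBE, Module.End.one_apply]

theorem extend_coneBracket_one (h : X.Hom Z) (g : Y.Hom Z) {A : ArtAlg.{u} 𝕜}
    (l : A ⊗[𝕜] L) (n : A ⊗[𝕜] N) (m : A ⊗[𝕜] M) :
    extend A 1 (coneBracket h g 1) (fun _ => coneElt A l n m) =
      coneElt A (-X.dA A l) (-Y.dA A n)
        (Z.dA A m - (h.toLin.baseChange A l - g.toLin.baseChange A n)) := by
  change extend A 1 (MultilinearMap.ofSubsingleton 𝕜 _ _ (0 : Fin 1) (-coneD h g)) _ = _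
  rw [extend_ofSubsingleton, LinearMap.baseChange_neg, LinearMap.neg_apply, coneD_coneElt,
    ← neg_one_smul 𝕜, coneElt_smul]
  congr 1 <;> module

theorem extend_coneBracket_two (h : X.Hom Z) (g : Y.Hom Z) {A : ArtAlg.{u} 𝕜}
    {l : A ⊗[𝕜] L} {n : A ⊗[𝕜] N} {m : A ⊗[𝕜] M} (hl : l ∈ X.coeff A 1) (hn : n ∈ Y.coeff A 1)
    (hm : m ∈ Z.coeff A 0) :
    ((Nat.factorial 2 : ℕ) : 𝕜)⁻¹ •
      extend A 2 (coneBracket h g 2) (fun _ => coneElt A l n m) =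
      coneElt A (-((2 : 𝕜)⁻¹ • X.bracketA A l l)) (-((2 : 𝕜)⁻¹ • Y.bracketA A n n))
        (-Z.bracketA A m (g.toLin.baseChange A n) - (2 : 𝕜)⁻¹ • Z.bracketA A m
            (h.toLin.baseChange A l - g.toLin.baseChange A n)) := by
  rw [coneBracket, Contraction.extend_bracket_const _ 0 (coneElt_mem_coeff hl hn hm), tree_zero,
    extend_consMap, extend_ofSubsingleton, LinearMap.baseChange_id, LinearMap.id_apply]
  change _ • _ • bilinBaseChange A _ (coneElt A l n m) (coneElt A l n m) = _
  rw [binaryTree_coneElt h g hl hn hm, coneElt_smul, coneElt_smul]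
  simp only [Nat.factorial_two, zero_add]
  congr 1 <;> · push_cast; module

theorem extend_coneBracket_succ (h : X.Hom Z) (g : Y.Hom Z) {A : ArtAlg.{u} 𝕜}
    {l : A ⊗[𝕜] L} {n : A ⊗[𝕜] N} {m : A ⊗[𝕜] M} (hl : l ∈ X.coeff A 1) (hn : n ∈ Y.coeff A 1)
    (hm : m ∈ Z.coeff A 0) (k : ℕ) :
    (((k + 3).factorial : ℕ) : 𝕜)⁻¹ •
      extend A (k + 3) (coneBracket h g (k + 3)) (fun _ => coneElt A l n m) =
      coneElt A 0 0 (-(((((k + 2).factorial : ℕ) : 𝕜)⁻¹ * ((bernoulli (k + 2) : ℚ) : 𝕜)) •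
        (Z.bracketA A m ^ (k + 2)) (h.toLin.baseChange A l - g.toLin.baseChange A n))) := by
  rw [coneBracket, Contraction.extend_bracket_const _ (k + 1) (coneElt_mem_coeff hl hn hm),
    tree_succ, map_smul, smul_apply, extend_comp, extend_chain h g hm, coneElt_zero_zero,
    ← LinearMap.map_smul_of_tower, ← LinearMap.map_smul_of_tower, ← LinearMap.map_smul_of_tower,
    smul_smul, smul_smul, smul_smul]
  have hf : (((k + 3).factorial : ℕ) : 𝕜) ≠ 0 := by exact_mod_cast Nat.factorial_ne_zero _
  have hs : (-1 : 𝕜) ^ k * (-1) ^ k = 1 := by rw [← mul_pow]; simp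
  have hc : (((k + 3).factorial : ℕ) : 𝕜)⁻¹ * ((-1 : 𝕜) ^ (k + 1) / 2 *
      (((k + 1 + 2).factorial : ℕ) : 𝕜)) *
        ((((k + 2).factorial : ℕ) : 𝕜)⁻¹ * ((bernoulli (k + 2) : ℚ) : 𝕜)) *
          (2 * (-1) ^ (k + 1 + 1)) =
      -((((k + 2).factorial : ℕ) : 𝕜)⁻¹ * ((bernoulli (k + 2) : ℚ) : 𝕜)) := by
    calc _ = -((((((k + 3).factorial : ℕ) : 𝕜)⁻¹ * (((k + 3).factorial : ℕ) : 𝕜)) *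
          ((-1 : 𝕜) ^ k * (-1) ^ k)) *
          ((((k + 2).factorial : ℕ) : 𝕜)⁻¹ * ((bernoulli (k + 2) : ℚ) : 𝕜))) := by ring
      _ = _ := by rw [inv_mul_cancel₀ hf, hs, one_mul, one_mul]
  exact congrArg _ ((congrArg (fun c : 𝕜 => c • (Z.bracketA A m ^ (k + 2))
    (h.toLin.baseChange A l - g.toLin.baseChange A n)) hc).trans (by module))

/-- The left-hand side of the Maurer-Cartan equation of the cone. With `u = h(l) - g(n)` and
`a = [m, -]`, its component in `M` is `dm - [m, h(l)] - (a / (e^a - 1)) u`. -/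
theorem finsum_coneBracket (h : X.Hom Z) (g : Y.Hom Z) {A : ArtAlg.{u} 𝕜} {l : A ⊗[𝕜] L}
    {n : A ⊗[𝕜] N} {m : A ⊗[𝕜] M} (hl : l ∈ X.coeff A 1) (hn : n ∈ Y.coeff A 1)
    (hm : m ∈ Z.coeff A 0) {K : ℕ} (hK : maximalIdeal A ^ (K + 2) = ⊥) :
    ∑ᶠ j : ℕ, (((j + 1).factorial : ℕ) : 𝕜)⁻¹ •
        extend A (j + 1) (coneBracket h g (j + 1)) (fun _ => coneElt A l n m) =
      coneElt A (-(X.dA A l + (2 : 𝕜)⁻¹ • X.bracketA A l l))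
        (-(Y.dA A n + (2 : 𝕜)⁻¹ • Y.bracketA A n n))
        (Z.dA A m - Z.bracketA A m (h.toLin.baseChange A l) -
          ∑ j ∈ Finset.range (K + 2), (((j.factorial : ℕ) : 𝕜)⁻¹ * ((bernoulli j : ℚ) : 𝕜)) •
            (Z.bracketA A m ^ j) (h.toLin.baseChange A l - g.toLin.baseChange A n)) := by
  rw [finsum_eq_sum_range (N := K + 2) fun j hj => ?_]
  -- the terms of index `0` and `1` come from the differential and the binary bracket
  · rw [Finset.sum_range_succ', Finset.sum_range_succ', Finset.sum_range_succ',
      Finset.sum_range_succ']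
    rw [Finset.sum_congr rfl fun k _ => extend_coneBracket_succ h g hl hn hm k]
    simp only [coneElt_zero_zero]
    rw [← map_sum, ← coneElt_zero_zero, zero_add, extend_coneBracket_two h g hl hn hm,
      extend_coneBracket_one]
    simp only [zero_add, Nat.factorial_one, Nat.cast_one, inv_one, one_smul, coneElt_add,
      Nat.factorial_zero, bernoulli_zero, bernoulli_one, pow_one, pow_zero, Module.End.one_apply,
      Rat.cast_one, mul_one, one_mul, Finset.sum_neg_distrib, map_sub]
    congr 1
    · abel
    · abel
    -- here `g(n)` is `h(l) - u`, and the terms linear in `a` match because of `B₁ = -1/2`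
    · push_cast
      module
  · rw [eq_zero_of_mem_pow_smul_top hK (hj.trans j.le_succ)
      (multilinear_mem_pow_smul_top (maximalIdeal A) (j + 1)
        (extend A (j + 1) (coneBracket h g (j + 1))) (fun _ => coneElt A l n m)
        fun _ => coeff_le_smul_top _ _ (coneElt_mem_coeff hl hn hm)), smul_zero]

/-- The explicit form of the Maurer-Cartan equation of the cone. -/
theorem isMCInfty_coneElt_iff (h : X.Hom Z) (g : Y.Hom Z) {A : ArtAlg.{u} 𝕜} {l : A ⊗[𝕜] L}
    {n : A ⊗[𝕜] N} {m : A ⊗[𝕜] M} (hl : l ∈ X.coeff A 1) (hn : n ∈ Y.coeff A 1)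
    (hm : m ∈ Z.coeff A 0) :
    IsMCInfty (coneGrading X Y Z) (coneBracket h g) A (coneElt A l n m) ↔
      X.dA A l + (2 : 𝕜)⁻¹ • X.bracketA A l l = 0 ∧
      Y.dA A n + (2 : 𝕜)⁻¹ • Y.bracketA A n n = 0 ∧
      g.toLin.baseChange A n = Z.gauge A m (h.toLin.baseChange A l) := by
  obtain ⟨K, hK⟩ : ∃ K, maximalIdeal A ^ (K + 2) = ⊥ := by
    obtain ⟨K, hK⟩ := exists_maximalIdeal_pow_eq_bot A
    exact ⟨K, by rw [pow_add, hK, Ideal.bot_mul]⟩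
  rw [IsMCInfty, and_iff_right (coneElt_mem_coeff hl hn hm),
    finsum_coneBracket h g hl hn hm hK, coneElt_eq_zero, neg_eq_zero, neg_eq_zero]
  refine and_congr_right fun _ => and_congr_right fun _ => ?_
  rw [sub_eq_zero, eq_comm, ← neg_sub (Z.bracketA A m (h.toLin.baseChange A l)),
    bernoulli_sum_eq_neg_iff (bracketA_pow_eq_zero hK hm le_rfl), gauge_eq_sum_range hK hm]
  constructor
  · intro hu
    rw [← sub_sub_cancel (h.toLin.baseChange A l) (g.toLin.baseChange A n), hu, sub_neg_eq_add]
  · intro hu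
    rw [hu]
    abel

end MaurerCartan

/-! ### The isomorphism of functors -/

section Functors

variable {𝕜 : Type*} [Field 𝕜] {L N M : Type v} [AddCommGroup L] [Module 𝕜 L]
  [AddCommGroup N] [Module 𝕜 N] [AddCommGroup M] [Module 𝕜 M]
  {X : DGLA 𝕜 L} {Y : DGLA 𝕜 N} {Z : DGLA 𝕜 M}

theorem mapCoeff_coneElt {A B : ArtAlg.{u} 𝕜} (f : A ⟶ B) (l : A ⊗[𝕜] L) (n : A ⊗[𝕜] N)
    (m : A ⊗[𝕜] M) :
    ArtAlg.mapCoeff f (L × N × M) (coneElt A l n m) =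
      coneElt B (ArtAlg.mapCoeff f L l) (ArtAlg.mapCoeff f N n) (ArtAlg.mapCoeff f M m) := by
  simp only [coneElt, map_add, mapCoeff_baseChange]

variable [CharZero 𝕜]

/-- The bijection `(l, n, e^m) ↦ (l, n, m)` from `MC_(h,g)(A)` to `MC^∞(A)`. -/
noncomputable def mcPairEquiv (h : X.Hom Z) (g : Y.Hom Z) (A : ArtAlg.{u} 𝕜) :
    (mcPair.{u} h g).obj A ≃ (mcInfty.{u} (coneGrading X Y Z) (coneBracket h g)).obj A where
  toFun w := ⟨coneElt A w.1.1 w.1.2.1 w.1.2.2.log,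
    (isMCInfty_coneElt_iff h g w.2.1.1 w.2.2.1.1 w.1.2.2.log_mem).2
      ⟨w.2.1.2, w.2.2.1.2, w.2.2.2⟩⟩
  invFun γ :=
    have hl : (coneFst 𝕜 L N M).baseChange A γ.1 ∈ X.coeff A 1 :=
      baseChange_mem_coeff (coneGrading X Y Z) X.toGrading (fun _ hv => hv.1) γ.2.1
    have hn : (coneSnd 𝕜 L N M).baseChange A γ.1 ∈ Y.coeff A 1 :=
      baseChange_mem_coeff (coneGrading X Y Z) Y.toGrading (fun _ hv => hv.2.1) γ.2.1
    have hm : (coneThd 𝕜 L N M).baseChange A γ.1 ∈ Z.coeff A 0 :=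
      baseChange_mem_coeff (coneGrading X Y Z) Z.toGrading (fun _ hv => hv.2.2) γ.2.1
    have hγ := (isMCInfty_coneElt_iff h g hl hn hm).1 ((coneElt_proj γ.1).symm ▸ γ.2)
    ⟨(_, _, ⟨_, hm⟩), ⟨hl, hγ.1⟩, ⟨hn, hγ.2.1⟩, hγ.2.2⟩
  left_inv _ := Subtype.ext (Prod.ext (coneFst_coneElt _ _ _)
    (Prod.ext (coneSnd_coneElt _ _ _) (Expo.ext (coneThd_coneElt _ _ _))))
  right_inv γ := Subtype.ext (coneElt_proj γ.1)

/-- The isomorphism of functors `(l, n, e^m) ↦ (l, n, m)`. -/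
noncomputable def mcPairIso (h : X.Hom Z) (g : Y.Hom Z) :
    CategoryTheory.Iso (mcPair.{u} h g) (mcInfty.{u} (coneGrading X Y Z) (coneBracket h g)) :=
  CategoryTheory.NatIso.ofComponents (fun A => (mcPairEquiv h g A).toIso) fun f => by
    apply CategoryTheory.ConcreteCategory.hom_ext
    intro w
    exact Subtype.ext (mapCoeff_coneElt f _ _ _).symm

end Functors

theorem mainTheorem6 {L N M : Type v}
    [AddCommGroup L] [Module ℂ L] [AddCommGroup N] [Module ℂ N] [AddCommGroup M] [Module ℂ M]
    {X : DGLA ℂ L} {Y : DGLA ℂ N} {Z : DGLA ℂ M} (h : X.Hom Z) (g : Y.Hom Z) :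
    -- the two Maurer-Cartan functors coincide, through `(l, n, e^m) ↔ (l, n, m)`
    (∃ e : CategoryTheory.Iso (mcPair.{u} h g)
        (mcInfty.{u} (coneGrading X Y Z) (coneBracket h g)),
      ∀ (A : ArtAlg.{u} ℂ) (w : (mcPair.{u} h g).obj A),
        (e.hom.app A w).1 = coneElt A w.1.1 w.1.2.1 w.1.2.2.log) ∧
    -- the Maurer-Cartan equation of the cone in explicit form
    (∀ (A : ArtAlg.{u} ℂ) (l : A ⊗[ℂ] L) (n : A ⊗[ℂ] N) (m : A ⊗[ℂ] M),
      l ∈ X.coeff A 1 → n ∈ Y.coeff A 1 → m ∈ Z.coeff A 0 →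
      (IsMCInfty (coneGrading X Y Z) (coneBracket h g) A (coneElt A l n m) ↔
        X.dA A l + (2 : ℂ)⁻¹ • X.bracketA A l l = 0 ∧
        Y.dA A n + (2 : ℂ)⁻¹ • Y.bracketA A n n = 0 ∧
        g.toLin.baseChange A n = Z.gauge A m (h.toLin.baseChange A l))) ∧
    -- the explicit brackets
    (∀ (m : M) (l : L), m ∈ Z.deg 0 →
      coneBracket h g 2 ![(0, 0, m), (l, 0, 0)] =
        (0, 0, -((2 : ℂ)⁻¹ • Z.bracket m (h.toLin l)))) ∧
    (∀ (j : ℕ) (m : M) (l : L), 2 ≤ j → m ∈ Z.deg 0 →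
      coneBracket h g (j + 1)
          (Fin.snoc (α := fun _ => L × N × M) (fun _ => (0, 0, m)) (l, 0, 0)) =
        (0, 0, -(((bernoulli j : ℚ) : ℂ) • ((Z.bracket m) ^ j) (h.toLin l)))) ∧
    (∀ (j : ℕ) (m : M) (n : N), 1 ≤ j → m ∈ Z.deg 0 →
      coneBracket h g (j + 1)
          (Fin.snoc (α := fun _ => L × N × M) (fun _ => (0, 0, m)) (0, n, 0)) =
        (0, 0, ((bernoulli j : ℚ) : ℂ) • ((Z.bracket m) ^ j) (g.toLin n))) := by

  refine ⟨⟨mcPairIso h g, fun _ _ => rfl⟩,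
    fun A l n m hl hn hm => isMCInfty_coneElt_iff h g hl hn hm, fun m l hm => ?_,
    fun j m l hj hm => ?_, fun j m n hj hm => ?_⟩
  · have hv : (![(0, 0, m), (l, 0, 0)] : Fin 2 → L × N × M) =
        Function.update (fun _ => (0, 0, m)) 1 (l, 0, 0) := by
      ext1 i
      fin_cases i <;> rfl
    rw [hv, coneBracket_two_update h g hm, map_zero, add_zero]
  · obtain ⟨k, rfl⟩ := Nat.exists_eq_add_of_le' hj
    rw [snoc_const_eq_update, coneBracket_succ_succ_succ_update h g hm]
    simp [coneSlope]
  · obtain ⟨k, rfl⟩ := Nat.exists_eq_add_of_le' hj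
    rw [snoc_const_eq_update]
    rcases k with _ | k
    · rw [coneBracket_two_update h g hm]
      simp [bernoulli_one, neg_div]
    · rw [coneBracket_succ_succ_succ_update h g hm]
      simp [coneSlope]
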